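/- Let $n,K,N\ge 0$ and let $L_1,\dots,L_K$ (signal) and $L_{K+1},\dots,L_{K+N}$ (noise) be pairwise distinct, traceless, pairwise commuting $n$-qubit Pauli operators (tensor products of the single-qubit matrices $I,\sigma_x,\sigma_y,\sigma_z$) on $\mathbb C^{d}$, $d=2^n$. Let $\gamma_{K+1},\dots,\gamma_{K+N}>0$, let $T>0$, and for $s>0$ consider the evolution $$\dot\rho = s^2\sum_{j=1}^{K}\mathcal L_j(\rho)+\sum_{k=K+1}^{K+N}\gamma_k\mathcal L_k(\rho),\qquad \mathcal L_j(\rho)=L_j\rho L_j^\dagger-\tfrac12\{L_j^\dagger L_j,\rho\},$$ where $s=\sqrt{\gamma_1}$ is the parameter to be estimated (the square root of the common signal decay rate). All Fisher informations are taken with respect to $s$: the classical Fisher information of outcome probabilities $p_x(s)$ is $\sum_{x:\,p_x(s)\ne 0}(\partial_s p_x)^2/p_x$, and a quantum Fisher information (QFI) is the supremum of the classical one over all measurements (POVMs with finitely many outcomes). A quantity $F_M(s)$ is said to have the value $v$ in the fast-control, vanishing-signal limit if $J(s)=\lim_{M\to\infty}F_M(s)$ exists for every $s>0$ and $\lim_{s\to0^+}J(s)=v$.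 An extended sequential strategy with $M$ steps starts from a joint state of the system and a noiseless finite-dimensional ancilla, applies the evolution for a time $T/M$ (acting trivially on the ancilla) $M$ times, each time followed by an arbitrary joint quantum channel, and ends with a joint POVM. The unextended measure-and-reset strategy with state $|\psi\rangle\in\mathbb C^d$ performs $M$ rounds, each of which prepares $|\psi\rangle$ without ancilla, evolves it for a time $T/M$ and measures it with the same POVM; its Fisher information is that of the record of the $M$ outcomes. Then: 1. The noiseless QFI (that is, without the noise operators), defined as the value in the above limit of the supremum of the Fisher information over all extended sequential strategies, is $4KT$. It equals $4T\max_{|\varphi\rangle}\sum_{j=1}^K\mathrm{Var}_{|\varphi\rangle}(L_j\otimes I)$, the maximum being over all unit vectors $|\varphi\rangle\in\mathbb C^d\otimes\mathbb C^{A}$ with finite-dimensional ancilla, where $\mathrm{Var}_{|\varphi\rangle}(B)=\langle\varphi|B^\dagger B|\varphi\rangle-|\langle\varphi|B|\varphi\rangle|^2$. 2. An orthonormal basis of simultaneous eigenvectors of $L_1,\dots,L_{K+N}$ exists. For every such basis $\{|e_j\rangle\}_{j=1}^d$, let $|\psi\rangle=\frac1{\sqrt d}\sum_{j=1}^d|e_j\rangle$,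 which is a unit vector. In the presence of all the noise operators, the QFI of the unextended measure-and-reset strategy with state $|\psi\rangle$ has the same value $4KT$ in the above limit: the noiseless QFI is recovered. The value $4KT$ is already attained by the two-outcome measurement $\{\Pi,I-\Pi\}$, where $\Pi$ is the orthogonal projection onto $\mathrm{span}\{|\psi\rangle,L_{K+1}|\psi\rangle,\dots,L_{K+N}|\psi\rangle\}$, and $4T\sum_{j=1}^K\langle\psi|L_j^\dagger(I-\Pi)L_j|\psi\rangle=4KT$. -/

import Mathlib

open scoped ComplexOrder ENNReal Kronecker Topology

namespace LindbladSensing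

/-- Density matrices. -/
def IsDensity {d : Type} [Fintype d] (ρ : Matrix d d ℂ) : Prop :=
  ρ.PosSemidef ∧ ρ.trace = 1

/-- Quantum channels, in Kraus form `ρ ↦ ∑ᵢ κᵢ ρ κᵢᴴ` with `∑ᵢ κᵢᴴ κᵢ = 1`. -/
def IsChannel {d : Type} [Fintype d] [DecidableEq d]
    (Φ : Matrix d d ℂ → Matrix d d ℂ) : Prop :=
  ∃ (r : ℕ) (κ : Fin r → Matrix d d ℂ),
    ∑ i, (κ i).conjTranspose * κ i = 1 ∧ ∀ ρ, Φ ρ = ∑ i, κ i * ρ * (κ i).conjTranspose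

/-- Positive operator-valued measures with finitely many outcomes. -/
def IsPOVM {d X : Type} [Fintype d] [DecidableEq d] [Fintype X]
    (E : X → Matrix d d ℂ) : Prop :=
  (∀ x, (E x).PosSemidef) ∧ ∑ x, E x = 1

/-- Born rule: probability of the effect `E` in the state `ρ`. -/
noncomputable def born {d : Type} [Fintype d] (ρ E : Matrix d d ℂ) : ℝ :=
  (ρ * E).trace.re

/-- The density matrix `|ψ⟩⟨ψ|` of a pure state. -/
noncomputable def pureState {d : Type} (ψ : EuclideanSpace ℂ d) : Matrix d d ℂ :=
  Matrix.of fun a b => ψ a * star (ψ b)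

/-- The operator given by a matrix on the Hilbert space `ℂ^d`. -/
noncomputable abbrev op {d : Type} [Fintype d] [DecidableEq d] (B : Matrix d d ℂ) :
    EuclideanSpace ℂ d →ₗ[ℂ] EuclideanSpace ℂ d :=
  Matrix.toEuclideanLin B

/-- The variance `⟨ψ|Bᴴ B|ψ⟩ - |⟨ψ|B|ψ⟩|²`. -/
noncomputable def variance {d : Type} [Fintype d] [DecidableEq d]
    (ψ : EuclideanSpace ℂ d) (B : Matrix d d ℂ) : ℝ :=
  (inner ℂ ψ (op (B.conjTranspose * B) ψ)).re - ‖inner ℂ ψ (op B ψ)‖ ^ 2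

/-- Classical Fisher information about the parameter of a family of probability distributions on a
finite set. Outcomes of probability zero contribute `0`, since `y / 0 = 0`. -/
noncomputable def fisherInfo {X : Type} [Fintype X] (p : ℝ → X → ℝ) (θ : ℝ) : ℝ :=
  ∑ x, (deriv (fun s => p s x) θ) ^ 2 / p θ x

/-- The Lindbladian `ρ ↦ ∑ⱼ rⱼ (Lⱼ ρ Lⱼᴴ - ½ {Lⱼᴴ Lⱼ, ρ})`. -/
noncomputable def lindbladian {d J : Type} [Fintype d] [DecidableEq d] [Fintype J]
    (r : J → ℝ) (L : J → Matrix d d ℂ) : Module.End ℂ (Matrix d d ℂ) :=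
  ∑ j, (r j : ℂ) •
    (LinearMap.mulLeftRight ℂ (L j, (L j).conjTranspose)
      - (1 / 2 : ℂ) • (LinearMap.mulLeft ℂ ((L j).conjTranspose * L j)
          + LinearMap.mulRight ℂ ((L j).conjTranspose * L j)))

/-- The solution `exp (t 𝓛) ρ = ∑ₖ (tᵏ / k!) 𝓛ᵏ ρ` at time `t` of `dρ/dt = 𝓛 ρ` with initial
value `ρ`. -/
noncomputable def evolve {d : Type} (𝓛 : Module.End ℂ (Matrix d d ℂ)) (t : ℝ)
    (ρ : Matrix d d ℂ) : Matrix d d ℂ :=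
  ∑' k : ℕ, ((t ^ k / k.factorial : ℝ) : ℂ) • (𝓛 ^ k) ρ

/-- A Lindblad estimation problem without Hamiltonian: `K` signal jump operators with a common
unknown decay rate, and `N` noise jump operators with known decay rates. -/
structure Model (d : Type) (K N : ℕ) where
  signal : Fin K → Matrix d d ℂ
  noise : Fin N → Matrix d d ℂ
  noiseRate : Fin N → ℝ

namespace Model

variable {d : Type} {K N : ℕ}

/-- The same signals without any noise. -/
def noiseless (S : Model d K N) : Model d K 0 where
  signal := S.signal
  noise := Fin.elim0
  noiseRate := Fin.elim0

/-- The same jump operators in the presence of a noiseless ancilla `A`: `L ⊗ 1`. -/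
noncomputable def extend (S : Model d K N) (A : Type) [DecidableEq A] : Model (d × A) K N where
  signal j := S.signal j ⊗ₖ (1 : Matrix A A ℂ)
  noise k := S.noise k ⊗ₖ (1 : Matrix A A ℂ)
  noiseRate := S.noiseRate

/-- Evolution for a time `t` when the parameter `s`, the square root of the signal decay rate, is
to be estimated: the signal decay rate is `s ^ 2`. -/
noncomputable def channel [Fintype d] [DecidableEq d] (S : Model d K N) (s t : ℝ) :
    Matrix d d ℂ → Matrix d d ℂ :=
  evolve (lindbladian (Sum.elim (fun _ => s ^ 2) S.noiseRate) (Sum.elim S.signal S.noise)) t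

/-- Measure-and-reset: `M` rounds of duration `T / M`, each of which prepares `ψ`, lets it evolve
and measures `E`. This is the Fisher information about `s` in the record of the `M` outcomes. -/
noncomputable def measureResetInfo [Fintype d] [DecidableEq d] (S : Model d K N)
    (ψ : EuclideanSpace ℂ d) {X : Type} [Fintype X] (E : X → Matrix d d ℂ)
    (T : ℝ) (M : ℕ) (s : ℝ) : ℝ :=
  fisherInfo
    (fun s' (x : Fin M → X) => ∏ m, born (S.channel s' (T / M) (pureState ψ)) (E (x m))) s

/-- Quantum Fisher information of the measure-and-reset strategy that prepares `ψ`: the Fisher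
information maximised over all measurements. -/
noncomputable def measureResetQFI [Fintype d] [DecidableEq d] (S : Model d K N)
    (ψ : EuclideanSpace ℂ d) (T : ℝ) (M : ℕ) (s : ℝ) : ℝ≥0∞ :=
  ⨆ (X : Type) (_ : Fintype X) (E : X → Matrix d d ℂ) (_ : IsPOVM E),
    ENNReal.ofReal (S.measureResetInfo ψ E T M s)

end Model

/-- An extended sequential strategy: a noiseless ancilla, an initial joint state of system and
ancilla, a joint control operation after each use of the unknown evolution, and a final joint
measurement. -/
structure Strategy (d : Type) [Fintype d] [DecidableEq d] where
  Ancilla : Type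
  [fintypeAncilla : Fintype Ancilla]
  [decEqAncilla : DecidableEq Ancilla]
  init : Matrix (d × Ancilla) (d × Ancilla) ℂ
  isDensity_init : IsDensity init
  control : ℕ → Matrix (d × Ancilla) (d × Ancilla) ℂ → Matrix (d × Ancilla) (d × Ancilla) ℂ
  isChannel_control : ∀ m, IsChannel (control m)
  Outcome : Type
  [fintypeOutcome : Fintype Outcome]
  effect : Outcome → Matrix (d × Ancilla) (d × Ancilla) ℂ
  isPOVM_effect : IsPOVM effect

attribute [instance] Strategy.fintypeAncilla Strategy.decEqAncilla Strategy.fintypeOutcome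

/-- The joint state after `m` uses of an evolution of duration `t`, each followed by a control. -/
noncomputable def Strategy.state {d : Type} [Fintype d] [DecidableEq d] {K N : ℕ}
    (C : Strategy d) (S : Model d K N) (s t : ℝ) :
    ℕ → Matrix (d × C.Ancilla) (d × C.Ancilla) ℂ
  | 0 => C.init
  | m + 1 => C.control m ((S.extend C.Ancilla).channel s t (C.state S s t m))

namespace Model

variable {d : Type} {K N : ℕ}

/-- Quantum Fisher information about `s` of the best extended sequential strategy with total time
`T` and `M` control operations at intervals `T / M`. -/
noncomputable def sequentialQFI [Fintype d] [DecidableEq d] (S : Model d K N)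
    (T : ℝ) (M : ℕ) (s : ℝ) : ℝ≥0∞ :=
  ⨆ C : Strategy d, ENNReal.ofReal
    (fisherInfo (fun s' (x : C.Outcome) => born (C.state S s' (T / M) M) (C.effect x)) s)

/-- The noisy subspace, spanned by `ψ` and its images under the noise operators. -/
noncomputable def noisySubspace [Fintype d] [DecidableEq d] (S : Model d K N)
    (ψ : EuclideanSpace ℂ d) : Submodule ℂ (EuclideanSpace ℂ d) :=
  Submodule.span ℂ (insert ψ (Set.range fun k => op (S.noise k) ψ))

/-- The matrix of the orthogonal projection onto the noisy subspace. -/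
noncomputable def noisyProjection [Fintype d] [DecidableEq d] (S : Model d K N)
    (ψ : EuclideanSpace ℂ d) : Matrix d d ℂ :=
  Matrix.toEuclideanLin.symm ((S.noisySubspace ψ).starProjection).toLinearMap

/-- The two-outcome measurement `{Π, 1 - Π}` with `Π` the projection onto the noisy subspace. -/
noncomputable def noisyMeasurement [Fintype d] [DecidableEq d] (S : Model d K N)
    (ψ : EuclideanSpace ℂ d) : Fin 2 → Matrix d d ℂ :=
  ![S.noisyProjection ψ, 1 - S.noisyProjection ψ]

end Model

/-- `v` is the value of an information quantity `F M s` in the limit of fast control (`M → ∞`, that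
is, time steps tending to `0`) followed by the limit of a vanishing signal (`s → 0⁺`). -/
def IsVanishingSignalValue (F : ℕ → ℝ → ℝ≥0∞) (v : ℝ≥0∞) : Prop :=
  ∃ J : ℝ → ℝ≥0∞,
    (∀ s, 0 < s → Filter.Tendsto (fun M => F M s) Filter.atTop (𝓝 (J s))) ∧
      Filter.Tendsto J (𝓝[>] 0) (𝓝 v)

/-- The single-qubit Pauli matrices `1, X, Y, Z`. -/
noncomputable def pauli : Fin 4 → Matrix (Fin 2) (Fin 2) ℂ :=
  ![1, !![0, 1; 1, 0], !![0, -Complex.I; Complex.I, 0], !![1, 0; 0, -1]]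

/-- The `n`-qubit Pauli operator `⊗ᵢ pauli (w i)`, in the computational basis `Fin n → Fin 2`. -/
noncomputable def pauliString {n : ℕ} (w : Fin n → Fin 4) :
    Matrix (Fin n → Fin 2) (Fin n → Fin 2) ℂ :=
  Matrix.of fun x y => ∏ i, pauli (w i) (x i) (y i)

/-- The estimation problem in which every jump operator is a Pauli operator. -/
noncomputable def pauliModel {n K N : ℕ} (sig : Fin K → Fin n → Fin 4)
    (noi : Fin N → Fin n → Fin 4) (γ : Fin N → ℝ) : Model (Fin n → Fin 2) K N where
  signal j := pauliString (sig j)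
  noise k := pauliString (noi k)
  noiseRate := γ

/-- `e` is an orthonormal basis of simultaneous eigenvectors of all jump operators. -/
def IsEigenbasis {d : Type} [Fintype d] [DecidableEq d] {K N : ℕ} (S : Model d K N)
    (e : OrthonormalBasis d ℂ (EuclideanSpace ℂ d)) : Prop :=
  (∀ j a, ∃ c : ℂ, op (S.signal j) (e a) = c • e a) ∧
    ∀ k a, ∃ c : ℂ, op (S.noise k) (e a) = c • e a

/-- The uniform superposition `(1/√d) ∑ⱼ eⱼ`. -/
noncomputable def uniformSuperposition {d : Type} [Fintype d]
    (e : OrthonormalBasis d ℂ (EuclideanSpace ℂ d)) : EuclideanSpace ℂ d :=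
  ((1 / Real.sqrt (Fintype.card d) : ℝ) : ℂ) • ∑ a, e a

end LindbladSensing

open LindbladSensing

/-! ### Classical Fisher information: additivity and data processing. -/

namespace LindbladSensing

/-! Upper bound. A Pauli jump operator is a Hermitian involution, so its dissipator is ρ ↦ LρL - ρ,
and the dissipators of commuting jumps commute. Evolution for a time t is therefore a composition of
independent random flips: L with rate r is applied with probability (1 - exp(-2rt))/2. The parameter
s enters only through the flip bits of the K signals, and each such bit carries Fisher information
at most 4t (`flipInfo_sq_le`). Hence, at every stage of a strategy, the state is a mixture of states
independent of s whose weights carry information at most 4K times the elapsed time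
(`HasSimulation`). Controls act on the fixed states, and the final measurement is a stochastic
post-processing of the weights. This gives 4KT for every M and every s > 0, with or without noise or
ancilla.

Lower bound. In the uniform superposition ψ of a joint eigenbasis, a diagonal operator A has
expectation tr A / d. Distinct Pauli strings are trace-orthogonal, so every signal image of ψ is
orthogonal to ψ and to all noise images. Thus the effect 1 - Π fires with probability p(t) = s²Kt +
o(t): to first order the noise is invisible and each signal jump is seen. Its s-derivative is 2sKt +
o(t), and M rounds with t = T/M yield at least M(2sKt)²/(s²Kt) in the limit, that is 4KT
(`tendsto_measureResetInfo`). For the noiseless optimum, measure-and-reset is realised as a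
sequential strategy that stores its outcomes in the ancilla (`recordStrategy`).

Both bounds hold at each fixed s > 0, so the fast-control limit is already constant in s and the
limit s → 0⁺ is trivial. -/

/-- Families of probability distributions on a finite set that are differentiable at `θ`. -/
structure IsSmoothFamily {X : Type} [Fintype X] (p : ℝ → X → ℝ) (θ : ℝ) : Prop where
  nonneg : ∀ s x, 0 ≤ p s x
  sum_eq_one : ∀ s, ∑ x, p s x = 1
  differentiableAt : ∀ x, DifferentiableAt ℝ (fun s => p s x) θ

namespace IsSmoothFamily

variable {X Y : Type} [Fintype X] [Fintype Y] {p : ℝ → X → ℝ} {q : ℝ → Y → ℝ} {θ : ℝ}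

/-- A zero of a nonnegative function is a minimum. This makes the convention y / 0 = 0 harmless: an
outcome of probability zero also has zero numerator. -/
theorem deriv_eq_zero (hp : IsSmoothFamily p θ) {x : X} (hx : p θ x = 0) :
    deriv (fun s => p s x) θ = 0 := by
  refine IsLocalMin.deriv_eq_zero (Filter.Eventually.of_forall fun s => ?_)
  simpa [hx] using hp.nonneg s x

theorem sum_deriv (hp : IsSmoothFamily p θ) : ∑ x, deriv (fun s => p s x) θ = 0 := by
  rw [← deriv_fun_sum fun x _ => hp.differentiableAt x]
  simp [hp.sum_eq_one]

theorem prodMk (hp : IsSmoothFamily p θ) (hq : IsSmoothFamily q θ) :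
    IsSmoothFamily (fun s (z : X × Y) => p s z.1 * q s z.2) θ where
  nonneg s z := mul_nonneg (hp.nonneg s _) (hq.nonneg s _)
  sum_eq_one s := by
    rw [Fintype.sum_prod_type]
    simp [← Finset.mul_sum, hp.sum_eq_one, hq.sum_eq_one]
  differentiableAt z := (hp.differentiableAt _).mul (hq.differentiableAt _)

/-- Expanding (p'q + pq')² / (pq), the cross term 2p'q' sums to zero because the derivatives of
probabilities sum to zero. -/
theorem fisherInfo_prod (hp : IsSmoothFamily p θ) (hq : IsSmoothFamily q θ) :
    fisherInfo (fun s (z : X × Y) => p s z.1 * q s z.2) θ = fisherInfo p θ + fisherInfo q θ := by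
  have key : ∀ z : X × Y, (deriv (fun s => p s z.1 * q s z.2) θ) ^ 2 / (p θ z.1 * q θ z.2)
      = (deriv (fun s => p s z.1) θ) ^ 2 / p θ z.1 * q θ z.2
        + 2 * deriv (fun s => p s z.1) θ * deriv (fun s => q s z.2) θ
        + p θ z.1 * ((deriv (fun s => q s z.2) θ) ^ 2 / q θ z.2) := by
    intro z
    rw [deriv_fun_mul (hp.differentiableAt _) (hq.differentiableAt _)]
    by_cases h1 : p θ z.1 = 0
    · simp [h1, hp.deriv_eq_zero h1]
    by_cases h2 : q θ z.2 = 0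
    · simp [h2, hq.deriv_eq_zero h2]
    field_simp
    ring
  unfold fisherInfo
  rw [Finset.sum_congr rfl fun z _ => key z, Finset.sum_add_distrib, Finset.sum_add_distrib,
    Fintype.sum_prod_type, Fintype.sum_prod_type, Fintype.sum_prod_type]
  simp only [← Finset.mul_sum, ← Finset.sum_mul, hp.sum_eq_one, hq.sum_eq_one, hp.sum_deriv,
    hq.sum_deriv]
  simp

theorem pi (hp : IsSmoothFamily p θ) (M : ℕ) :
    IsSmoothFamily (fun s (x : Fin M → X) => ∏ m, p s (x m)) θ where
  nonneg s x := Finset.prod_nonneg fun m _ => hp.nonneg s _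
  sum_eq_one s := by
    classical
    have := Finset.prod_univ_sum (fun _ : Fin M => (Finset.univ : Finset X)) (fun _ x => p s x)
    simpa [hp.sum_eq_one] using this.symm
  differentiableAt x := by
    refine DifferentiableAt.fun_finsetProd fun m _ => hp.differentiableAt _

theorem fisherInfo_equiv (e : X ≃ Y) (q : ℝ → Y → ℝ) (θ : ℝ) :
    fisherInfo (fun s x => q s (e x)) θ = fisherInfo q θ :=
  e.sum_comp fun y => (deriv (fun s => q s y) θ) ^ 2 / q θ y

theorem fisherInfo_pi (hp : IsSmoothFamily p θ) (M : ℕ) :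
    fisherInfo (fun s (x : Fin M → X) => ∏ m, p s (x m)) θ = M * fisherInfo p θ := by
  induction M with
  | zero => simp [fisherInfo]
  | succ M ih =>
    rw [← fisherInfo_equiv (Fin.consEquiv fun _ => X)]
    have : (fun s (x : X × (Fin M → X)) => ∏ m, p s ((Fin.consEquiv fun _ => X) x m))
        = fun s x => p s x.1 * ∏ m, p s (x.2 m) := by
      funext s x
      rw [Fin.prod_univ_succ]
      simp [Fin.consEquiv]
    rw [this, hp.fisherInfo_prod (hp.pi M), ih]
    push_cast
    ring

/-- Stochastic post-processing does not increase the Fisher information. -/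
theorem fisherInfo_postprocess_le (hp : IsSmoothFamily p θ) (k : X → Y → ℝ)
    (hk : ∀ x y, 0 ≤ k x y) (hk1 : ∀ x, ∑ y, k x y = 1) :
    fisherInfo (fun s y => ∑ x, p s x * k x y) θ ≤ fisherInfo p θ := by
  have key : ∀ y, (deriv (fun s => ∑ x, p s x * k x y) θ) ^ 2 / (∑ x, p θ x * k x y)
      ≤ ∑ x, (deriv (fun s => p s x) θ) ^ 2 / p θ x * k x y := by
    intro y
    rw [deriv_fun_sum fun x _ => (hp.differentiableAt x).mul_const _]
    simp only [deriv_mul_const (hp.differentiableAt _)]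
    refine div_le_of_le_mul₀ (Finset.sum_nonneg fun x _ => mul_nonneg (hp.nonneg _ _) (hk _ _))
      (Finset.sum_nonneg fun x _ => mul_nonneg (div_nonneg (sq_nonneg _) (hp.nonneg _ _))
        (hk _ _)) ?_
    -- Cauchy–Schwarz, splitting p' k as the geometric mean of (p'² / p) k and p k.
    refine Finset.sum_sq_le_sum_mul_sum_of_sq_le_mul _
      (fun x _ => mul_nonneg (div_nonneg (sq_nonneg _) (hp.nonneg _ _)) (hk _ _))
      (fun x _ => mul_nonneg (hp.nonneg _ _) (hk _ _)) fun x _ => ?_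
    by_cases h : p θ x = 0
    · simp [h, hp.deriv_eq_zero h]
    · apply le_of_eq
      field_simp
  calc fisherInfo (fun s y => ∑ x, p s x * k x y) θ
      ≤ ∑ y, ∑ x, (deriv (fun s => p s x) θ) ^ 2 / p θ x * k x y :=
        Finset.sum_le_sum fun y _ => key y
    _ = fisherInfo p θ := by
        rw [Finset.sum_comm]
        simp [← Finset.mul_sum, hk1, fisherInfo]

theorem postprocess (hp : IsSmoothFamily p θ) (k : X → Y → ℝ)
    (hk : ∀ x y, 0 ≤ k x y) (hk1 : ∀ x, ∑ y, k x y = 1) :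
    IsSmoothFamily (fun s y => ∑ x, p s x * k x y) θ where
  nonneg s y := Finset.sum_nonneg fun x _ => mul_nonneg (hp.nonneg _ _) (hk _ _)
  sum_eq_one s := by
    rw [Finset.sum_comm]
    simp [← Finset.mul_sum, hk1, hp.sum_eq_one]
  differentiableAt y := DifferentiableAt.fun_sum fun x _ => (hp.differentiableAt x).mul_const _

end IsSmoothFamily


/-! ### The series defining `evolve` as an operator exponential. -/

section Exponential

variable {E : Type} [NormedAddCommGroup E] [NormedSpace ℂ E] [FiniteDimensional ℂ E]

theorem hasSum_exp_apply (A : Module.End ℂ E) (t : ℝ) (v : E) :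
    HasSum (fun k : ℕ => ((t ^ k / k.factorial : ℝ) : ℂ) • (A ^ k) v)
      (NormedSpace.exp ((t : ℂ) • Module.End.toContinuousLinearMap E A) v) := by
  have := FiniteDimensional.complete ℂ E
  have h := NormedSpace.exp_series_hasSum_exp' (𝕂 := ℂ)
    ((t : ℂ) • Module.End.toContinuousLinearMap E A)
  have h2 := h.mapL (ContinuousLinearMap.apply ℂ E v)
  convert h2 using 1
  · funext k
    rw [smul_pow, ← map_pow]
    simp only [ContinuousLinearMap.apply_apply, smul_apply, smul_smul]
    congr 1
    push_cast
    ring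
  · rfl

theorem exp_toContinuousLinearMap_add {A B : Module.End ℂ E} (h : Commute A B) (c : ℂ) (v : E) :
    NormedSpace.exp (c • Module.End.toContinuousLinearMap E (A + B)) v
      = NormedSpace.exp (c • Module.End.toContinuousLinearMap E A)
        (NormedSpace.exp (c • Module.End.toContinuousLinearMap E B) v) := by
  have := FiniteDimensional.complete ℂ E
  let _ : NormedAlgebra ℚ (E →L[ℂ] E) := NormedAlgebra.restrictScalars ℚ ℂ _
  rw [map_add, smul_add, NormedSpace.exp_add_of_commute]
  · rfl
  · exact ((h.map _).smul_left _).smul_right _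

theorem hasDerivAt_exp_apply (A : Module.End ℂ E) (v : E) (t : ℝ) :
    HasDerivAt
      (fun t : ℝ => NormedSpace.exp ((t : ℂ) • Module.End.toContinuousLinearMap E A) v)
      (A (NormedSpace.exp ((t : ℂ) • Module.End.toContinuousLinearMap E A) v)) t := by
  have := FiniteDimensional.complete ℂ E
  have h := (hasDerivAt_exp_smul_const' (𝕂 := ℂ) (Module.End.toContinuousLinearMap E A) (t : ℂ))
  have h2 := (ContinuousLinearMap.apply ℂ E v).hasFDerivAt.comp_hasDerivAt (t : ℂ) h
  have h3 := h2.scomp t Complex.ofRealCLM.hasDerivAt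
  rw [Complex.ofRealCLM_apply, Complex.ofReal_one, one_smul] at h3
  exact h3

end Exponential

section Evolve

variable {d : Type} [Fintype d]

attribute [local instance] Matrix.normedAddCommGroup Matrix.normedSpace

/-- The evolution as an exponential in the algebra of bounded operators. -/
theorem hasSum_evolve (A : Module.End ℂ (Matrix d d ℂ)) (t : ℝ) (ρ : Matrix d d ℂ) :
    HasSum (fun k : ℕ => ((t ^ k / k.factorial : ℝ) : ℂ) • (A ^ k) ρ)
      (NormedSpace.exp ((t : ℂ) • Module.End.toContinuousLinearMap (Matrix d d ℂ) A) ρ) := by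
  exact hasSum_exp_apply A t ρ

theorem evolve_eq_exp (A : Module.End ℂ (Matrix d d ℂ)) (t : ℝ) (ρ : Matrix d d ℂ) :
    evolve A t ρ
      = NormedSpace.exp ((t : ℂ) • Module.End.toContinuousLinearMap (Matrix d d ℂ) A) ρ :=
  (hasSum_evolve A t ρ).tsum_eq

theorem evolve_add {A B : Module.End ℂ (Matrix d d ℂ)} (h : Commute A B) (t : ℝ)
    (ρ : Matrix d d ℂ) : evolve (A + B) t ρ = evolve A t (evolve B t ρ) := by
  simp only [evolve_eq_exp]
  exact exp_toContinuousLinearMap_add h _ ρ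

theorem evolve_smul (A : Module.End ℂ (Matrix d d ℂ)) (r t : ℝ) (ρ : Matrix d d ℂ) :
    evolve ((r : ℂ) • A) t ρ = evolve A (r * t) ρ := by
  simp only [evolve_eq_exp, map_smul, smul_smul]
  push_cast
  rw [mul_comm]

theorem evolve_zero_time (A : Module.End ℂ (Matrix d d ℂ)) (ρ : Matrix d d ℂ) :
    evolve A 0 ρ = ρ := by
  simp [evolve_eq_exp]

theorem evolve_zero (t : ℝ) (ρ : Matrix d d ℂ) :
    evolve (0 : Module.End ℂ (Matrix d d ℂ)) t ρ = ρ := by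
  simp [evolve_eq_exp]

theorem hasDerivAt_evolve (A : Module.End ℂ (Matrix d d ℂ)) (ρ : Matrix d d ℂ) (t : ℝ) :
    HasDerivAt (fun t => evolve A t ρ) (A (evolve A t ρ)) t := by
  simp only [evolve_eq_exp]
  exact hasDerivAt_exp_apply A ρ t

/-- An intertwiner of the generators intertwines all their powers, hence the series. It serves to
adjoin an ancilla, with F = (· ⊗ τ). -/
theorem evolve_intertwine {d' : Type} [Fintype d'] (F : Matrix d d ℂ →ₗ[ℂ] Matrix d' d' ℂ)
    (A : Module.End ℂ (Matrix d d ℂ)) (B : Module.End ℂ (Matrix d' d' ℂ))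
    (h : ∀ ρ, F (A ρ) = B (F ρ)) (t : ℝ) (ρ : Matrix d d ℂ) :
    evolve B t (F ρ) = F (evolve A t ρ) := by
  have hk : ∀ k : ℕ, (B ^ k) (F ρ) = F ((A ^ k) ρ) := by
    intro k
    induction k with
    | zero => simp
    | succ k ih => rw [pow_succ', pow_succ', Module.End.mul_apply, Module.End.mul_apply, ih, h]
  have h1 := (hasSum_evolve A t ρ).mapL (LinearMap.toContinuousLinearMap F)
  have h2 := hasSum_evolve B t (F ρ)
  rw [evolve_eq_exp, evolve_eq_exp]
  refine h2.unique (h1.congr_fun ?_)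
  intro k
  simp [hk]

/-- The semigroup generated by an involution minus the identity is a Bernoulli mixture. -/
theorem evolve_involution (P : Module.End ℂ (Matrix d d ℂ)) (hP : P * P = 1) (t : ℝ)
    (ρ : Matrix d d ℂ) :
    evolve (P - 1) t ρ = ((1 - (1 - Real.exp (-2 * t)) / 2 : ℝ) : ℂ) • ρ
      + (((1 - Real.exp (-2 * t)) / 2 : ℝ) : ℂ) • P ρ := by
  have hPP : P (P ρ) = ρ := by simpa using congrArg (fun f : Module.End ℂ _ => f ρ) hP
  -- P - 1 kills ρ + Pρ and multiplies ρ - Pρ by -2; the case k = 0 is the convention 0⁰ = 1.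
  have hk : ∀ k : ℕ, ((P - 1) ^ k) ρ = (if k = 0 then (1 / 2 : ℂ) • (ρ + P ρ) else 0)
      + ((-2 : ℂ) ^ k * (1 / 2)) • (ρ - P ρ) := by
    intro k
    induction k with
    | zero => simp; module
    | succ k ih =>
      rw [pow_succ', Module.End.mul_apply, ih]
      by_cases h0 : k = 0
      · subst h0
        simp [hPP]; module
      · simp [h0, hPP, pow_succ]; module
  have h1 : HasSum (fun k : ℕ => (t : ℂ) ^ k / (k.factorial : ℂ) *
      ((if k = 0 then (1 / 2 : ℂ) else 0))) (1 / 2) := by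
    convert hasSum_ite_eq (0 : ℕ) (1 / 2 : ℂ) using 2 with k
    split_ifs with h <;> simp [h]
  have h2 : HasSum (fun k : ℕ => ((-2 : ℂ) * t) ^ k / (k.factorial : ℂ)) (Complex.exp (-2 * t)) := by
    rw [Complex.exp_eq_exp_ℂ]
    exact NormedSpace.expSeries_div_hasSum_exp _
  have h3 := (h1.smul_const (ρ + P ρ)).add ((h2.mul_right (1 / 2)).smul_const (ρ - P ρ))
  have h4 := (hasSum_evolve (P - 1) t ρ).unique (h3.congr_fun ?_)
  · rw [evolve_eq_exp, h4]
    push_cast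
    module
  · intro k
    rw [hk]
    split_ifs with h
    · simp [h]
    · push_cast
      module

end Evolve


/-! ### Born probabilities and channels. -/

section Born

variable {d : Type} [Fintype d]

theorem born_nonneg {ρ E : Matrix d d ℂ} (hρ : ρ.PosSemidef) (hE : E.PosSemidef) :
    0 ≤ born ρ E := by
  classical
  obtain ⟨m, v, rfl⟩ := Matrix.posSemidef_iff_eq_sum_vecMulVec.mp hE
  rw [born, Finset.mul_sum, Matrix.trace_sum, Complex.re_sum]
  refine Finset.sum_nonneg fun i _ => ?_
  rw [Matrix.mul_vecMulVec, Matrix.trace_vecMulVec, dotProduct_comm]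
  exact hρ.re_dotProduct_nonneg _

theorem born_sum_smul {Ω : Type} [Fintype Ω] (w : Ω → ℝ) (σ : Ω → Matrix d d ℂ)
    (E : Matrix d d ℂ) : born (∑ ω, (w ω : ℂ) • σ ω) E = ∑ ω, w ω * born (σ ω) E := by
  simp [born, Finset.sum_mul, Matrix.trace_sum]

theorem born_sub (ρ σ E : Matrix d d ℂ) : born (ρ - σ) E = born ρ E - born σ E := by
  simp [born, sub_mul]

theorem born_add (ρ σ E : Matrix d d ℂ) : born (ρ + σ) E = born ρ E + born σ E := by
  simp [born, add_mul]

theorem born_smul (c : ℝ) (ρ E : Matrix d d ℂ) : born ((c : ℂ) • ρ) E = c * born ρ E := by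
  simp [born]

theorem born_sum {J : Type} [Fintype J] (σ : J → Matrix d d ℂ) (E : Matrix d d ℂ) :
    born (∑ j, σ j) E = ∑ j, born (σ j) E := by
  simp [born, Finset.sum_mul, Matrix.trace_sum]

theorem sum_born [DecidableEq d] {X : Type} [Fintype X] {E : X → Matrix d d ℂ} (hE : IsPOVM E)
    (ρ : Matrix d d ℂ) : ∑ x, born ρ (E x) = ρ.trace.re := by
  simp only [born]
  rw [← Complex.re_sum, ← Matrix.trace_sum, ← Finset.mul_sum, hE.2, mul_one]

theorem IsDensity.map_isChannel [DecidableEq d] {Φ : Matrix d d ℂ → Matrix d d ℂ}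
    (hΦ : IsChannel Φ) {ρ : Matrix d d ℂ} (hρ : IsDensity ρ) : IsDensity (Φ ρ) := by
  obtain ⟨r, κ, hκ, h⟩ := hΦ
  rw [h]
  refine ⟨Matrix.posSemidef_sum _ fun i _ => hρ.1.mul_mul_conjTranspose_same _, ?_⟩
  rw [Matrix.trace_sum, ← hρ.2]
  simp_rw [Matrix.trace_mul_comm (κ _ * ρ), ← Matrix.mul_assoc]
  rw [← Matrix.trace_sum, ← Finset.sum_mul, hκ, one_mul]

theorem isChannel_conj [DecidableEq d] {U : Matrix d d ℂ} (hU : U.conjTranspose * U = 1) :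
    IsChannel fun ρ => U * ρ * U.conjTranspose :=
  ⟨1, fun _ => U, by simpa using hU, fun ρ => by simp⟩

theorem IsChannel.map_sum_smul [DecidableEq d] {Φ : Matrix d d ℂ → Matrix d d ℂ}
    (hΦ : IsChannel Φ) {Ω : Type} [Fintype Ω] (w : Ω → ℂ) (σ : Ω → Matrix d d ℂ) :
    Φ (∑ ω, w ω • σ ω) = ∑ ω, w ω • Φ (σ ω) := by
  obtain ⟨r, κ, hκ, h⟩ := hΦ
  simp only [h, Finset.mul_sum, Finset.sum_mul, Finset.smul_sum, Matrix.mul_smul, Matrix.smul_mul]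
  rw [Finset.sum_comm]

end Born

/-! ### Classical simulation of parameter-dependent states. -/

section Simulation

variable {d : Type} [Fintype d]

/-- The family `ρ` of states is a mixture of fixed states whose weights carry Fisher information
at most `b` about the parameter at `θ`. -/
def HasSimulation (ρ : ℝ → Matrix d d ℂ) (b θ : ℝ) : Prop :=
  ∃ (Ω : Type) (_ : Fintype Ω) (P : ℝ → Ω → ℝ) (σ : Ω → Matrix d d ℂ),
    IsSmoothFamily P θ ∧ fisherInfo P θ ≤ b ∧ (∀ ω, IsDensity (σ ω)) ∧
      ∀ s, ρ s = ∑ ω, (P s ω : ℂ) • σ ω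

variable {ρ : ℝ → Matrix d d ℂ} {b θ : ℝ}

theorem hasSimulation_const {ρ : Matrix d d ℂ} (hρ : IsDensity ρ) (θ : ℝ) :
    HasSimulation (fun _ => ρ) 0 θ :=
  ⟨Unit, inferInstance, fun _ _ => 1, fun _ => ρ,
    ⟨fun _ _ => zero_le_one, fun _ => by simp, fun _ => differentiableAt_const _⟩,
    by simp [fisherInfo], fun _ => hρ, fun _ => by simp⟩

namespace HasSimulation

theorem isDensity (h : HasSimulation ρ b θ) (s : ℝ) : IsDensity (ρ s) := by
  obtain ⟨Ω, _, P, σ, hP, hb, hσ, hρ⟩ := h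
  rw [hρ]
  constructor
  · refine Matrix.posSemidef_sum _ fun ω _ => (hσ ω).1.smul ?_
    exact_mod_cast hP.nonneg s ω
  · rw [Matrix.trace_sum]
    simp only [Matrix.trace_smul, (hσ _).2, smul_eq_mul, mul_one]
    exact_mod_cast hP.sum_eq_one s

variable [DecidableEq d]

/-- A channel independent of the parameter acts on the fixed states by linearity and leaves the
weights alone, so control costs no information. -/
theorem isChannel (h : HasSimulation ρ b θ) {Φ : Matrix d d ℂ → Matrix d d ℂ}
    (hΦ : IsChannel Φ) : HasSimulation (fun s => Φ (ρ s)) b θ := by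
  obtain ⟨Ω, _, P, σ, hP, hb, hσ, hρ⟩ := h
  exact ⟨Ω, _, P, fun ω => Φ (σ ω), hP, hb, fun ω => (hσ ω).map_isChannel hΦ,
    fun s => by simp only [hρ, hΦ.map_sum_smul]⟩

/-- A random unitary applied with a parameter-dependent probability `q` adds the Fisher
information of `q`. -/
theorem bernoulli (h : HasSimulation ρ b θ) {q : ℝ → ℝ} (h0 : ∀ s, 0 ≤ q s) (h1 : ∀ s, q s ≤ 1)
    (hq : DifferentiableAt ℝ q θ) {U : Matrix d d ℂ} (hU : U.conjTranspose * U = 1) :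
    HasSimulation
      (fun s => ((1 - q s : ℝ) : ℂ) • ρ s + (q s : ℂ) • (U * ρ s * U.conjTranspose))
      (b + ((deriv q θ) ^ 2 / (1 - q θ) + (deriv q θ) ^ 2 / q θ)) θ := by
  obtain ⟨Ω, _, P, σ, hP, hb, hσ, hρ⟩ := h
  have hB : IsSmoothFamily (fun s => ![1 - q s, q s]) θ := by
    refine ⟨fun s x => ?_, fun s => by simp, fun x => ?_⟩
    · fin_cases x
      · simpa using h1 s
      · simpa using h0 s
    · fin_cases x
      · simpa using hq.const_sub 1
      · simpa using hq
  have hBI : fisherInfo (fun s => ![1 - q s, q s]) θ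
      = (deriv q θ) ^ 2 / (1 - q θ) + (deriv q θ) ^ 2 / q θ := by
    simp [fisherInfo, Fin.sum_univ_two]
  refine ⟨Ω × Fin 2, inferInstance, fun s z => P s z.1 * ![1 - q s, q s] z.2,
    fun z => if z.2 = 0 then σ z.1 else U * σ z.1 * U.conjTranspose, hP.prodMk hB, ?_, ?_, ?_⟩
  · rw [hP.fisherInfo_prod hB, hBI]
    gcongr
  · intro z
    dsimp only
    split_ifs
    · exact hσ _
    · exact (hσ _).map_isChannel (isChannel_conj hU)
  · intro s
    rw [Fintype.sum_prod_type]
    simp only [Fin.sum_univ_two, hρ s]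
    simp only [Finset.sum_add_distrib, Finset.smul_sum, Finset.mul_sum, Finset.sum_mul, smul_smul,
      Matrix.mul_smul, Matrix.smul_mul]
    simp [mul_comm]

/-- The outcome probabilities of the fixed states form a stochastic kernel from the mixture index to
the outcomes, so data processing applies. -/
theorem born (h : HasSimulation ρ b θ) {X : Type} [Fintype X] {E : X → Matrix d d ℂ}
    (hE : IsPOVM E) :
    IsSmoothFamily (fun s x => LindbladSensing.born (ρ s) (E x)) θ ∧
      fisherInfo (fun s x => LindbladSensing.born (ρ s) (E x)) θ ≤ b := by
  obtain ⟨Ω, _, P, σ, hP, hb, hσ, hρ⟩ := h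
  have hk : ∀ ω x, 0 ≤ LindbladSensing.born (σ ω) (E x) := fun ω x => born_nonneg (hσ ω).1 (hE.1 x)
  have hk1 : ∀ ω, ∑ x, LindbladSensing.born (σ ω) (E x) = 1 := fun ω => by
    rw [sum_born hE, (hσ ω).2, Complex.one_re]
  simp only [hρ, born_sum_smul]
  exact ⟨hP.postprocess _ hk hk1, (hP.fisherInfo_postprocess_le _ hk hk1).trans hb⟩

end HasSimulation

/-- The probability that an involutive jump operator with rate `r` acts an odd number of times
within time `t`. -/
noncomputable def flipProb (r t : ℝ) : ℝ := (1 - Real.exp (-2 * (r * t))) / 2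

/-- Fisher information carried by the parity of the number of jumps. -/
noncomputable def flipInfo (r : ℝ → ℝ) (t θ : ℝ) : ℝ :=
  (deriv (fun s => flipProb (r s) t) θ) ^ 2 / (1 - flipProb (r θ) t)
    + (deriv (fun s => flipProb (r s) t) θ) ^ 2 / flipProb (r θ) t

theorem flipInfo_const (r t θ : ℝ) : flipInfo (fun _ => r) t θ = 0 := by
  simp [flipInfo]

/-- With τ = θ²t and x = exp(-2τ), the information equals 4t · 4τx² / (1 - x²). The last factor is
at most 1 because (1 + 4τ)x² ≤ 1, which is 1 + 4τ ≤ exp(4τ). -/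
theorem flipInfo_sq_le {t θ : ℝ} (ht : 0 ≤ t) (hθ : 0 < θ) :
    flipInfo (fun s => s ^ 2) t θ ≤ 4 * t := by
  have hd : HasDerivAt (fun s : ℝ => flipProb (s ^ 2) t)
      (2 * θ * t * Real.exp (-2 * (θ ^ 2 * t))) θ := by
    have := (((((hasDerivAt_pow 2 θ).mul_const t).const_mul (-2)).exp).const_sub 1).div_const 2
    refine this.congr_deriv ?_
    simp
    ring
  -- The degenerate case t = 0 does occur: it is T / M at M = 0.
  rcases ht.eq_or_lt with rfl | ht
  · simp [flipInfo, flipProb]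
  have hτ : 0 < θ ^ 2 * t := by positivity
  have hq : flipProb (θ ^ 2) t = (1 - Real.exp (-2 * (θ ^ 2 * t))) / 2 := rfl
  rw [flipInfo, hd.deriv, hq]
  have hx0 : 0 < Real.exp (-2 * (θ ^ 2 * t)) := Real.exp_pos _
  have hx1 : Real.exp (-2 * (θ ^ 2 * t)) < 1 := by
    rw [Real.exp_lt_one_iff]
    linarith
  have hx2 : (4 * (θ ^ 2 * t) + 1) * Real.exp (-2 * (θ ^ 2 * t)) ^ 2 ≤ 1 := by
    have h := Real.add_one_le_exp (4 * (θ ^ 2 * t))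
    calc _ ≤ Real.exp (4 * (θ ^ 2 * t)) * Real.exp (-2 * (θ ^ 2 * t)) ^ 2 := by gcongr
      _ = 1 := by
        rw [← Real.exp_nat_mul, ← Real.exp_add]
        simp
        ring
  set x := Real.exp (-2 * (θ ^ 2 * t))
  have h1 : 0 < 1 - x := by linarith
  have h2 : 0 < 1 + x := by linarith
  have e1 : (2 * θ * t * x) ^ 2 / (1 - (1 - x) / 2) + (2 * θ * t * x) ^ 2 / ((1 - x) / 2)
      = 4 * t * (4 * (θ ^ 2 * t) * x ^ 2 / ((1 - x) * (1 + x))) := by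
    have h3 : 1 - (1 - x) / 2 = (1 + x) / 2 := by ring
    rw [h3]
    field_simp
    ring
  rw [e1]
  refine mul_le_of_le_one_right (by positivity) ?_
  rw [div_le_one (by positivity)]
  nlinarith

end Simulation

/-! ### Commuting involutive jumps as independent random flips. -/

section Jumps

variable {d J : Type} [Fintype d] [DecidableEq d]

/-- Pairwise commuting Hermitian involutions. -/
structure IsInvolutive (L : J → Matrix d d ℂ) : Prop where
  isHermitian : ∀ j, (L j).IsHermitian
  mul_self : ∀ j, L j * L j = 1
  commute : ∀ i j, Commute (L i) (L j)

/-- Generator `ρ ↦ L ρ Lᴴ - ρ` of a unitary jump operator. -/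
noncomputable def jump (L : Matrix d d ℂ) : Module.End ℂ (Matrix d d ℂ) :=
  LinearMap.mulLeftRight ℂ (L, L.conjTranspose) - 1

theorem jump_apply (L ρ : Matrix d d ℂ) : jump L ρ = L * ρ * L.conjTranspose - ρ := by
  simp [jump]

theorem commute_jump {L L' : Matrix d d ℂ} (h : Commute L L')
    (h' : Commute L.conjTranspose L'.conjTranspose) : Commute (jump L) (jump L') := by
  refine LinearMap.ext fun ρ => ?_
  simp only [Module.End.mul_apply, jump_apply]
  have e1 : L * (L' * ρ * L'.conjTranspose) * L.conjTranspose
      = L' * (L * ρ * L.conjTranspose) * L'.conjTranspose := by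
    calc _ = (L * L') * ρ * (L'.conjTranspose * L.conjTranspose) := by simp only [mul_assoc]
      _ = (L' * L) * ρ * (L.conjTranspose * L'.conjTranspose) := by rw [h.eq, h'.eq]
      _ = _ := by simp only [mul_assoc]
  rw [mul_sub, sub_mul, e1, mul_sub, sub_mul]
  abel

/-- For a unitary jump the anticommutator term is ρ itself. -/
theorem lindbladian_eq_sum_jump [Fintype J] (r : J → ℝ) {L : J → Matrix d d ℂ}
    (hL : ∀ j, (L j).conjTranspose * L j = 1) :
    lindbladian r L = ∑ j, (r j : ℂ) • jump (L j) := by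
  refine Finset.sum_congr rfl fun j _ => ?_
  congr 1
  refine LinearMap.ext fun ρ => ?_
  simp only [hL, jump, LinearMap.sub_apply, LinearMap.smul_apply, LinearMap.add_apply,
    LinearMap.mulLeft_apply, LinearMap.mulRight_apply, one_mul, mul_one, Module.End.one_apply]
  module

namespace IsInvolutive

variable {L : J → Matrix d d ℂ}

theorem conjTranspose_mul_self (hL : IsInvolutive L) (j : J) : (L j).conjTranspose * L j = 1 := by
  rw [(hL.isHermitian j).eq, hL.mul_self]

theorem commute_jump (hL : IsInvolutive L) (i j : J) : Commute (jump (L i)) (jump (L j)) :=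
  LindbladSensing.commute_jump (hL.commute i j)
    (by rw [(hL.isHermitian i).eq, (hL.isHermitian j).eq]; exact hL.commute i j)

theorem evolve_jump (hL : IsInvolutive L) (j : J) (r t : ℝ) (ρ : Matrix d d ℂ) :
    evolve ((r : ℂ) • jump (L j)) t ρ = ((1 - flipProb r t : ℝ) : ℂ) • ρ
      + (flipProb r t : ℂ) • (L j * ρ * (L j).conjTranspose) := by
  rw [evolve_smul, jump, evolve_involution]
  · simp [flipProb]
  · refine LinearMap.ext fun ρ => ?_
    simp only [Module.End.mul_apply, LinearMap.mulLeftRight_apply, (hL.isHermitian j).eq]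
    calc _ = (L j * L j) * ρ * (L j * L j) := by simp only [mul_assoc]
      _ = ρ := by simp [hL.mul_self]

/-- Since the generators commute, the exponential factorises; each jump peeled off is one more
independent flip, and the information of independent flips adds. -/
theorem hasSimulation_evolve (hL : IsInvolutive L) {r : J → ℝ → ℝ} (hr : ∀ j s, 0 ≤ r j s) {b θ : ℝ}
    (hrd : ∀ j, DifferentiableAt ℝ (r j) θ) {t : ℝ} (ht : 0 ≤ t) {ρ : ℝ → Matrix d d ℂ}
    (h : HasSimulation ρ b θ) (F : Finset J) :
    HasSimulation (fun s => evolve (∑ j ∈ F, (r j s : ℂ) • jump (L j)) t (ρ s))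
      (b + ∑ j ∈ F, flipInfo (r j) t θ) θ := by
  classical
  induction F using Finset.induction_on with
  | empty => simpa [evolve_zero] using h
  | insert i F hi ih =>
    have e : ∀ s, evolve (∑ j ∈ insert i F, (r j s : ℂ) • jump (L j)) t (ρ s)
        = ((1 - flipProb (r i s) t : ℝ) : ℂ) • evolve (∑ j ∈ F, (r j s : ℂ) • jump (L j)) t (ρ s)
          + (flipProb (r i s) t : ℂ) •
            (L i * evolve (∑ j ∈ F, (r j s : ℂ) • jump (L j)) t (ρ s) * (L i).conjTranspose) := by
      intro s
      rw [Finset.sum_insert hi, evolve_add, hL.evolve_jump]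
      exact Commute.sum_right _ _ _ fun j _ =>
        ((hL.commute_jump i j).smul_left _).smul_right _
    have h1 : ∀ s, Real.exp (-2 * (r i s * t)) ≤ 1 := fun s => by
      rw [Real.exp_le_one_iff]
      nlinarith [mul_nonneg (hr i s) ht]
    simp only [e]
    rw [Finset.sum_insert hi, add_comm (flipInfo _ _ _), ← add_assoc]
    refine ih.bernoulli (fun s => ?_) (fun s => ?_) ?_ (hL.conjTranspose_mul_self i)
    · unfold flipProb
      linarith [h1 s]
    · unfold flipProb
      linarith [Real.exp_pos (-2 * (r i s * t))]
    · unfold flipProb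
      have := hrd i
      fun_prop

end IsInvolutive

end Jumps

/-! ### The upper bound 4KT for involutive models. -/

namespace Model

variable {d : Type} [Fintype d] [DecidableEq d] {K N : ℕ} {S : Model d K N}

/-- Jump operators that are pairwise commuting Hermitian involutions, with nonnegative rates. -/
structure IsInvolutive (S : Model d K N) : Prop where
  jumps : LindbladSensing.IsInvolutive (Sum.elim S.signal S.noise)
  rate_nonneg : ∀ k, 0 ≤ S.noiseRate k

namespace IsInvolutive

theorem channel_eq (hS : S.IsInvolutive) (s t : ℝ) (ρ : Matrix d d ℂ) :
    S.channel s t ρ = evolve (((s ^ 2 : ℝ) : ℂ) • ∑ j, jump (S.signal j)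
      + ∑ k, (S.noiseRate k : ℂ) • jump (S.noise k)) t ρ := by
  rw [channel, lindbladian_eq_sum_jump _ hS.jumps.conjTranspose_mul_self, Fintype.sum_sum_type,
    Finset.smul_sum]
  simp

theorem noiseless (hS : S.IsInvolutive) : S.noiseless.IsInvolutive where
  jumps :=
    { isHermitian := by rintro (j | j); exacts [hS.jumps.isHermitian (.inl j), j.elim0]
      mul_self := by rintro (j | j); exacts [hS.jumps.mul_self (.inl j), j.elim0]
      commute := by
        rintro (i | i) (j | j)
        exacts [hS.jumps.commute (.inl i) (.inl j), j.elim0, i.elim0, i.elim0] }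
  rate_nonneg k := k.elim0

theorem extend (hS : S.IsInvolutive) (A : Type) [Fintype A] [DecidableEq A] :
    (S.extend A).IsInvolutive where
  jumps := by
    have e : Sum.elim (S.extend A).signal (S.extend A).noise
        = fun a => Sum.elim S.signal S.noise a ⊗ₖ (1 : Matrix A A ℂ) := by
      funext a
      cases a <;> rfl
    rw [e]
    refine ⟨fun a => ?_, fun a => ?_, fun a b => ?_⟩
    · rw [Matrix.IsHermitian, Matrix.conjTranspose_kronecker, (hS.jumps.isHermitian a).eq,
        Matrix.conjTranspose_one]
    · rw [← Matrix.mul_kronecker_mul, hS.jumps.mul_self, mul_one, Matrix.one_kronecker_one]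
    · rw [Commute, SemiconjBy, ← Matrix.mul_kronecker_mul, ← Matrix.mul_kronecker_mul,
        (hS.jumps.commute a b).eq]
  rate_nonneg := hS.rate_nonneg

/-- Noise flips have probabilities independent of s and contribute nothing; each of the K signals
contributes at most 4t. -/
theorem hasSimulation_channel (hS : S.IsInvolutive) {b θ t : ℝ} (hθ : 0 < θ) (ht : 0 ≤ t)
    {ρ : ℝ → Matrix d d ℂ} (h : HasSimulation ρ b θ) :
    HasSimulation (fun s => S.channel s t (ρ s)) (b + 4 * K * t) θ := by
  have := hS.jumps.hasSimulation_evolve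
    (r := fun a s => Sum.elim (fun _ => s ^ 2) S.noiseRate a) (θ := θ)
    (by rintro (j | k) s; exacts [sq_nonneg s, hS.rate_nonneg k])
    (by rintro (j | k); exacts [differentiableAt_pow 2, differentiableAt_const _]) ht h Finset.univ
  simp only [channel]
  simp only [lindbladian_eq_sum_jump _ hS.jumps.conjTranspose_mul_self]
  obtain ⟨Ω, i, P, σ, hP, hb, hσ, hρ⟩ := this
  refine ⟨Ω, i, P, σ, hP, hb.trans ?_, hσ, hρ⟩
  rw [Fintype.sum_sum_type]
  simp only [Sum.elim_inl, Sum.elim_inr, flipInfo_const, Finset.sum_const_zero, add_zero,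
    Finset.sum_const, Finset.card_univ, Fintype.card_fin, nsmul_eq_mul]
  have := mul_le_mul_of_nonneg_left (flipInfo_sq_le ht hθ) (Nat.cast_nonneg (α := ℝ) K)
  linarith

end IsInvolutive

theorem measureReset_smooth (hS : S.IsInvolutive) {ψ : EuclideanSpace ℂ d}
    (hψ : IsDensity (pureState ψ)) {X : Type} [Fintype X] {E : X → Matrix d d ℂ} (hE : IsPOVM E)
    {t θ : ℝ} (ht : 0 ≤ t) (hθ : 0 < θ) :
    IsSmoothFamily (fun s x => born (S.channel s t (pureState ψ)) (E x)) θ ∧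
      fisherInfo (fun s x => born (S.channel s t (pureState ψ)) (E x)) θ ≤ 4 * K * t := by
  simpa using (hS.hasSimulation_channel hθ ht (hasSimulation_const hψ θ)).born hE

theorem measureResetInfo_eq (hS : S.IsInvolutive) {ψ : EuclideanSpace ℂ d}
    (hψ : IsDensity (pureState ψ)) {X : Type} [Fintype X] {E : X → Matrix d d ℂ} (hE : IsPOVM E)
    {T θ : ℝ} (hT : 0 ≤ T) (hθ : 0 < θ) (M : ℕ) :
    S.measureResetInfo ψ E T M θ
      = M * fisherInfo (fun s x => born (S.channel s (T / M) (pureState ψ)) (E x)) θ :=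
  (measureReset_smooth hS hψ hE (by positivity) hθ).1.fisherInfo_pi M

/-- Only an inequality, because at M = 0 the left side is 0. -/
theorem mul_div_le_self {T : ℝ} (hT : 0 ≤ T) (K M : ℕ) : M * (4 * K * (T / M)) ≤ 4 * K * T := by
  rcases Nat.eq_zero_or_pos M with rfl | hM
  · simp only [Nat.cast_zero, zero_mul]
    positivity
  · have : (M : ℝ) ≠ 0 := by positivity
    apply le_of_eq
    field_simp

theorem measureResetInfo_le (hS : S.IsInvolutive) {ψ : EuclideanSpace ℂ d}
    (hψ : IsDensity (pureState ψ)) {X : Type} [Fintype X] {E : X → Matrix d d ℂ} (hE : IsPOVM E)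
    {T θ : ℝ} (hT : 0 ≤ T) (hθ : 0 < θ) (M : ℕ) :
    S.measureResetInfo ψ E T M θ ≤ 4 * K * T := by
  rw [measureResetInfo_eq hS hψ hE hT hθ]
  exact (mul_le_mul_of_nonneg_left (measureReset_smooth hS hψ hE (by positivity) hθ).2
    (Nat.cast_nonneg _)).trans (mul_div_le_self hT K M)

theorem measureResetQFI_le (hS : S.IsInvolutive) {ψ : EuclideanSpace ℂ d}
    (hψ : IsDensity (pureState ψ)) {T θ : ℝ} (hT : 0 ≤ T) (hθ : 0 < θ) (M : ℕ) :
    S.measureResetQFI ψ T M θ ≤ ENNReal.ofReal (4 * K * T) :=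
  iSup_le fun _ => iSup_le fun _ => iSup_le fun _ => iSup_le fun hE =>
    ENNReal.ofReal_le_ofReal (measureResetInfo_le hS hψ hE hT hθ M)

/-- The ancilla keeps the jumps involutive and commuting, so each use of the evolution adds 4Kt, and
the control after it adds nothing. -/
theorem hasSimulation_state (hS : S.IsInvolutive) (C : Strategy d) {t θ : ℝ} (ht : 0 ≤ t)
    (hθ : 0 < θ) (m : ℕ) :
    HasSimulation (fun s => C.state S s t m) (m * (4 * K * t)) θ := by
  induction m with
  | zero => simpa [Strategy.state] using hasSimulation_const C.isDensity_init θ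
  | succ m ih =>
    have := ((hS.extend C.Ancilla).hasSimulation_channel hθ ht ih).isChannel (C.isChannel_control m)
    rw [show ((m + 1 : ℕ) : ℝ) * (4 * K * t) = m * (4 * K * t) + 4 * K * t by push_cast; ring]
    exact this

theorem sequentialQFI_le (hS : S.IsInvolutive) {T θ : ℝ} (hT : 0 ≤ T) (hθ : 0 < θ) (M : ℕ) :
    S.sequentialQFI T M θ ≤ ENNReal.ofReal (4 * K * T) :=
  iSup_le fun C => ENNReal.ofReal_le_ofReal <|
    ((hasSimulation_state hS C (by positivity) hθ M).born C.isPOVM_effect).2.trans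
      (mul_div_le_self hT K M)

end Model


/-! ### Derivatives of Born probabilities along the evolution. -/

section BornEvolve

variable {d : Type} [Fintype d]

attribute [local instance] Matrix.normedAddCommGroup Matrix.normedSpace

/-- Needed with F = 1, to differentiate probabilities, and with F the signal generator, for
continuity in t of the click rate. -/
theorem hasDerivAt_born_evolve (F A : Module.End ℂ (Matrix d d ℂ)) (ρ E : Matrix d d ℂ) (t : ℝ) :
    HasDerivAt (fun t => born (F (evolve A t ρ)) E) (born (F (A (evolve A t ρ))) E) t := by
  let ℓ : Matrix d d ℂ →ₗ[ℝ] ℝ :=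
    { toFun := fun X => born (F X) E
      map_add' := fun X Y => by simp [born, add_mul]
      map_smul' := fun c X => by
        rw [← Complex.coe_smul, map_smul]
        simp [born] }
  exact (LinearMap.toContinuousLinearMap ℓ).hasFDerivAt.comp_hasDerivAt t (hasDerivAt_evolve A ρ t)

end BornEvolve

/-! ### Matrices acting on state vectors. -/

section PureState

theorem pureState_eq_vecMulVec {d : Type} (ψ : EuclideanSpace ℂ d) :
    pureState ψ = Matrix.vecMulVec (WithLp.ofLp ψ) (star (WithLp.ofLp ψ)) := rfl

variable {d : Type} [Fintype d]

theorem isDensity_pureState {ψ : EuclideanSpace ℂ d} (hψ : ‖ψ‖ = 1) : IsDensity (pureState ψ) := by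
  rw [pureState_eq_vecMulVec]
  refine ⟨Matrix.posSemidef_vecMulVec_self_star _, ?_⟩
  rw [Matrix.trace_vecMulVec]
  have := inner_self_eq_norm_sq_to_K (𝕜 := ℂ) ψ
  rw [EuclideanSpace.inner_eq_star_dotProduct, hψ] at this
  simpa using this

variable [DecidableEq d]

theorem mul_pureState_mul (L : Matrix d d ℂ) (ψ : EuclideanSpace ℂ d) :
    L * pureState ψ * L.conjTranspose = pureState (op L ψ) := by
  rw [pureState_eq_vecMulVec, pureState_eq_vecMulVec, Matrix.mul_vecMulVec, Matrix.vecMulVec_mul]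
  simp [Matrix.star_mulVec]

theorem born_pureState (ψ : EuclideanSpace ℂ d) (E : Matrix d d ℂ) :
    born (pureState ψ) E = (inner ℂ ψ (op E ψ)).re := by
  rw [born, Matrix.trace_mul_comm, pureState_eq_vecMulVec, Matrix.mul_vecMulVec,
    Matrix.trace_vecMulVec, EuclideanSpace.inner_eq_star_dotProduct]
  simp

theorem op_mul (A B : Matrix d d ℂ) (v : EuclideanSpace ℂ d) : op (A * B) v = op A (op B v) := by
  simp [op]

theorem op_one (v : EuclideanSpace ℂ d) : op (1 : Matrix d d ℂ) v = v := by
  simp [op]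

theorem inner_op (A : Matrix d d ℂ) (v w : EuclideanSpace ℂ d) :
    inner ℂ (op A v) w = inner ℂ v (op A.conjTranspose w) := by
  rw [op, op, Matrix.toEuclideanLin_conjTranspose_eq_adjoint, LinearMap.adjoint_inner_right]

theorem norm_op_eq {U : Matrix d d ℂ} (hU : U.conjTranspose * U = 1) (v : EuclideanSpace ℂ d) :
    ‖op U v‖ = ‖v‖ := by
  have h : inner ℂ (op U v) (op U v) = inner ℂ v v := by
    rw [inner_op, ← op_mul, hU, op_one]
  rw [@norm_eq_sqrt_re_inner ℂ, @norm_eq_sqrt_re_inner ℂ, h]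

end PureState

/-! ### The lower bound: clicks outside the noisy subspace. -/

namespace Model

variable {d : Type} [Fintype d] [DecidableEq d] {K N : ℕ} {S : Model d K N}
  {ψ : EuclideanSpace ℂ d}

theorem op_noisyProjection (φ : EuclideanSpace ℂ d) :
    op (S.noisyProjection ψ) φ = (S.noisySubspace ψ).starProjection φ := by
  simp [op, noisyProjection]

theorem op_one_sub_noisyProjection (φ : EuclideanSpace ℂ d) :
    op (1 - S.noisyProjection ψ) φ = (S.noisySubspace ψ)ᗮ.starProjection φ := by
  rw [op, map_sub, LinearMap.sub_apply]
  change op 1 φ - op (S.noisyProjection ψ) φ = _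
  rw [op_one, op_noisyProjection, Submodule.starProjection_orthogonal_val]

theorem posSemidef_of_op_eq_starProjection {P : Matrix d d ℂ}
    (W : Submodule ℂ (EuclideanSpace ℂ d)) (h : ∀ φ, op P φ = W.starProjection φ) :
    P.PosSemidef := by
  rw [← Matrix.isPositive_toEuclideanLin_iff]
  have : Matrix.toEuclideanLin P = W.starProjection.toLinearMap := LinearMap.ext h
  rw [this]
  exact LinearMap.IsSymmetricProjection.isPositive
    (Submodule.isSymmetricProjection_starProjection W)

theorem isPOVM_noisyMeasurement (S : Model d K N) (ψ : EuclideanSpace ℂ d) :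
    IsPOVM (S.noisyMeasurement ψ) := by
  refine ⟨fun x => ?_, by simp [noisyMeasurement]⟩
  fin_cases x
  · exact posSemidef_of_op_eq_starProjection _ op_noisyProjection
  · exact posSemidef_of_op_eq_starProjection _ op_one_sub_noisyProjection

theorem mem_noisySubspace_self : ψ ∈ S.noisySubspace ψ :=
  Submodule.subset_span (Set.mem_insert _ _)

theorem op_noise_mem_noisySubspace (k : Fin N) : op (S.noise k) ψ ∈ S.noisySubspace ψ :=
  Submodule.subset_span (Set.mem_insert_of_mem _ ⟨k, rfl⟩)

theorem born_of_mem {φ : EuclideanSpace ℂ d} (h : φ ∈ S.noisySubspace ψ) :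
    born (pureState φ) (1 - S.noisyProjection ψ) = 0 := by
  rw [born_pureState, op_one_sub_noisyProjection,
    (S.noisySubspace ψ)ᗮ.starProjection_apply_eq_zero_iff.mpr
      (Submodule.le_orthogonal_orthogonal _ h)]
  simp

theorem born_of_mem_orthogonal {φ : EuclideanSpace ℂ d} (h : φ ∈ (S.noisySubspace ψ)ᗮ) :
    born (pureState φ) (1 - S.noisyProjection ψ) = ‖φ‖ ^ 2 := by
  rw [born_pureState, op_one_sub_noisyProjection, Submodule.starProjection_eq_self_iff.mpr h]
  simp [inner_self_eq_norm_sq_to_K, ← Complex.ofReal_pow]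

/-- The signal generator produces clicks outside the noisy subspace at rate `K`. -/
theorem born_signal (hS : S.IsInvolutive) (hψ : ‖ψ‖ = 1)
    (h : ∀ j, op (S.signal j) ψ ∈ (S.noisySubspace ψ)ᗮ) :
    born ((∑ j, jump (S.signal j)) (pureState ψ)) (1 - S.noisyProjection ψ) = K := by
  rw [LinearMap.sum_apply, born_sum]
  have : ∀ j, born (jump (S.signal j) (pureState ψ)) (1 - S.noisyProjection ψ) = 1 := fun j => by
    rw [jump_apply, mul_pureState_mul, born_sub, born_of_mem_orthogonal (h j),
      born_of_mem mem_noisySubspace_self,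
      norm_op_eq (U := S.signal j) (hS.jumps.conjTranspose_mul_self (.inl j)), hψ]
    norm_num
  simp [this]

/-- Both ψ and its noise images lie in the noisy subspace, where the effect 1 - Π never fires: the
noise is invisible to first order in t. -/
theorem born_noise :
    born ((∑ k, (S.noiseRate k : ℂ) • jump (S.noise k)) (pureState ψ))
      (1 - S.noisyProjection ψ) = 0 := by
  rw [LinearMap.sum_apply, born_sum]
  refine Finset.sum_eq_zero fun k _ => ?_
  rw [LinearMap.smul_apply, born_smul, jump_apply, mul_pureState_mul, born_sub,
    born_of_mem (op_noise_mem_noisySubspace k), born_of_mem mem_noisySubspace_self]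
  simp

theorem IsInvolutive.commute_signal_noise (hS : S.IsInvolutive) :
    Commute (∑ j, jump (S.signal j)) (∑ k, (S.noiseRate k : ℂ) • jump (S.noise k)) :=
  Commute.sum_left _ _ _ fun j _ => Commute.sum_right _ _ _ fun k _ =>
    (hS.jumps.commute_jump (.inl j) (.inr k)).smul_right _

/-- As signal and noise generators commute, the channel is the noise evolution followed by the
signal evolution for the effective time s²t; the chain rule gives the factor 2st. -/
theorem hasDerivAt_born_channel (hS : S.IsInvolutive) (ρ E : Matrix d d ℂ) (s t : ℝ) :
    HasDerivAt (fun s => born (S.channel s t ρ) E)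
      (2 * s * t * born ((∑ j, jump (S.signal j)) (S.channel s t ρ)) E) s := by
  have e : ∀ s, S.channel s t ρ = evolve (∑ j, jump (S.signal j)) (s ^ 2 * t)
      (evolve (∑ k, (S.noiseRate k : ℂ) • jump (S.noise k)) t ρ) := fun s => by
    rw [hS.channel_eq, evolve_add (hS.commute_signal_noise.smul_left _), evolve_smul]
  simp only [e]
  have h := (hasDerivAt_born_evolve 1 (∑ j, jump (S.signal j))
    (evolve (∑ k, (S.noiseRate k : ℂ) • jump (S.noise k)) t ρ) E (s ^ 2 * t)).comp s
      ((hasDerivAt_pow 2 s).mul_const t)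
  refine h.congr_deriv ?_
  simp
  ring

/-- Squeezed between the general bound and the contribution of the outcome 1 - Π. With t = T/M, that
outcome has probability about s²Kt and s-derivative about 2sKt. -/
theorem tendsto_measureResetInfo (hS : S.IsInvolutive) (hψ : ‖ψ‖ = 1)
    (h : ∀ j, op (S.signal j) ψ ∈ (S.noisySubspace ψ)ᗮ) {T s : ℝ} (hT : 0 < T) (hs : 0 < s) :
    Filter.Tendsto (fun M => S.measureResetInfo ψ (S.noisyMeasurement ψ) T M s) Filter.atTop
      (𝓝 (4 * K * T)) := by
  have hD := isDensity_pureState hψ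
  have hE := S.isPOVM_noisyMeasurement ψ
  have hupper := measureResetInfo_le hS hD hE hT.le hs
  have hsmooth := fun M : ℕ => measureReset_smooth hS hD hE (t := T / M) (by positivity) hs
  have hnonneg : ∀ M, 0 ≤ S.measureResetInfo ψ (S.noisyMeasurement ψ) T M s := fun M => by
    rw [measureResetInfo_eq hS hD hE hT.le hs]
    exact mul_nonneg (Nat.cast_nonneg _)
      (Finset.sum_nonneg fun x _ => div_nonneg (sq_nonneg _) ((hsmooth M).1.nonneg _ _))
  -- For K = 0 the quotient limit below would be 0 / 0, but then the upper bound is already 0.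
  rcases Nat.eq_zero_or_pos K with hK | hK
  · subst hK
    refine tendsto_const_nhds.congr fun M => le_antisymm ?_ (hupper M)
    simpa using hnonneg M
  set E := 1 - S.noisyProjection ψ with hEdef
  set p : ℝ → ℝ := fun t => born (S.channel s t (pureState ψ)) E with hp
  set g : ℝ → ℝ := fun t => born ((∑ j, jump (S.signal j)) (S.channel s t (pureState ψ))) E
    with hg
  have hp0 : p 0 = 0 := by
    simp only [hp, hS.channel_eq, evolve_zero_time]
    exact born_of_mem mem_noisySubspace_self
  have hpd : HasDerivAt p (s ^ 2 * K) 0 := by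
    have := hasDerivAt_born_evolve 1 (((s ^ 2 : ℝ) : ℂ) • ∑ j, jump (S.signal j)
      + ∑ k, (S.noiseRate k : ℂ) • jump (S.noise k)) (pureState ψ) E 0
    simp only [hp, hS.channel_eq]
    refine this.congr_deriv ?_
    rw [evolve_zero_time, Module.End.one_apply, LinearMap.add_apply, LinearMap.smul_apply,
      born_add, born_smul, born_signal hS hψ h, born_noise, add_zero]
  have hgc : Filter.Tendsto g (𝓝 0) (𝓝 K) := by
    have := (hasDerivAt_born_evolve (∑ j, jump (S.signal j))
      (((s ^ 2 : ℝ) : ℂ) • ∑ j, jump (S.signal j)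
        + ∑ k, (S.noiseRate k : ℂ) • jump (S.noise k)) (pureState ψ) E 0).continuousAt
    simp only [ContinuousAt, evolve_zero_time, hEdef, born_signal hS hψ h] at this
    simpa only [hg, hS.channel_eq] using this
  have ht : Filter.Tendsto (fun M : ℕ => T / M) Filter.atTop (𝓝 0) :=
    tendsto_const_div_atTop_nhds_zero_nat T
  have ht' : Filter.Tendsto (fun M : ℕ => T / M) Filter.atTop (𝓝[≠] 0) := by
    refine tendsto_nhdsWithin_iff.mpr ⟨ht, ?_⟩
    filter_upwards [Filter.eventually_gt_atTop 0] with M hM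
    have : (0 : ℝ) < M := by exact_mod_cast hM
    exact (div_pos hT this).ne'
  have hslope : Filter.Tendsto (fun M : ℕ => (T / M)⁻¹ * p (T / M)) Filter.atTop
      (𝓝 (s ^ 2 * K)) := by
    have := (hasDerivAt_iff_tendsto_slope_zero.mp hpd).comp ht'
    simpa [Function.comp_def, hp0] using this
  -- The M-round information of the click outcome, rewritten so that numerator and denominator
  -- converge separately, the latter to a nonzero limit.
  have hlim : Filter.Tendsto
      (fun M : ℕ => T * (2 * s * g (T / M)) ^ 2 / ((T / M)⁻¹ * p (T / M))) Filter.atTop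
      (𝓝 (4 * K * T)) := by
    have hK' : (K : ℝ) ≠ 0 := by positivity
    have := ((((hgc.comp ht).const_mul (2 * s)).pow 2).const_mul T).div hslope (by positivity)
    have e : T * (2 * s * K) ^ 2 / (s ^ 2 * K) = 4 * K * T := by
      field_simp
      ring
    rw [← e]
    exact this
  refine tendsto_of_tendsto_of_tendsto_of_le_of_le' hlim tendsto_const_nhds ?_
    (Filter.Eventually.of_forall hupper)
  filter_upwards [Filter.eventually_gt_atTop 0] with M hM
  have hM' : (0 : ℝ) < M := by exact_mod_cast hM
  rw [measureResetInfo_eq hS hD hE hT.le hs, fisherInfo, Fin.sum_univ_two]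
  -- The outcome Π is simply discarded; its contribution is nonnegative.
  have h0 : 0 ≤ (deriv (fun s => born (S.channel s (T / M) (pureState ψ))
      (S.noisyMeasurement ψ 0)) s) ^ 2 / born (S.channel s (T / M) (pureState ψ))
      (S.noisyMeasurement ψ 0) :=
    div_nonneg (sq_nonneg _) ((hsmooth M).1.nonneg _ _)
  have h1 : deriv (fun s => born (S.channel s (T / M) (pureState ψ)) (S.noisyMeasurement ψ 1)) s
      = 2 * s * (T / M) * g (T / M) := (hasDerivAt_born_channel hS (pureState ψ) E s (T / M)).deriv
  have h2 : born (S.channel s (T / M) (pureState ψ)) (S.noisyMeasurement ψ 1) = p (T / M) := rfl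
  rw [h1, h2]
  calc T * (2 * s * g (T / M)) ^ 2 / ((T / M)⁻¹ * p (T / M))
      = M * ((2 * s * (T / M) * g (T / M)) ^ 2 / p (T / M)) := by
        by_cases hz : p (T / M) = 0
        · simp [hz]
        · field_simp
    _ ≤ _ := mul_le_mul_of_nonneg_left (le_add_of_nonneg_left h0) hM'.le

end Model


/-! ### Partially written outcome records. -/

section Record

variable {X : Type} [DecidableEq X] [AddCommGroup X]

/-- The distribution of a record of `M` outcomes of which only the first `m` have been written. -/
noncomputable def recordWeight (p : X → ℝ) (M m : ℕ) (f : Fin M → X) : ℝ :=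
  ∏ i : Fin M, if (i : ℕ) < m then p (f i) else if f i = 0 then 1 else 0

/-- The record with `x` in place `m` and zeros elsewhere. -/
def recordEntry (M m : ℕ) (x : X) (i : Fin M) : X := if (i : ℕ) = m then x else 0

theorem recordWeight_zero (p : X → ℝ) (M : ℕ) (f : Fin M → X) :
    recordWeight p M 0 f = if f = 0 then 1 else 0 := by
  simp [recordWeight, Finset.prod_ite_zero, funext_iff]

theorem recordWeight_self (p : X → ℝ) (M : ℕ) (f : Fin M → X) :
    recordWeight p M M f = ∏ i, p (f i) := by
  simp [recordWeight]

/-- Before round m, place m holds zero almost surely, so only the term with x equal to the entry of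
f at place m survives. -/
theorem sum_recordWeight_sub [Fintype X] (p : X → ℝ) {M m : ℕ} (hm : m < M) (f : Fin M → X) :
    ∑ x, p x * recordWeight p M m (f - recordEntry M m x) = recordWeight p M (m + 1) f := by
  have key : ∀ x, p x * recordWeight p M m (f - recordEntry M m x)
      = if f ⟨m, hm⟩ = x then recordWeight p M (m + 1) f else 0 := by
    intro x
    unfold recordWeight
    rw [← Finset.mul_prod_erase _ _ (Finset.mem_univ (⟨m, hm⟩ : Fin M)),
      ← Finset.mul_prod_erase _ _ (Finset.mem_univ (⟨m, hm⟩ : Fin M))]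
    have e : ∀ i ∈ Finset.univ.erase (⟨m, hm⟩ : Fin M),
        (if (i : ℕ) < m then p ((f - recordEntry M m x) i)
          else if (f - recordEntry M m x) i = 0 then (1 : ℝ) else 0)
        = if (i : ℕ) < m + 1 then p (f i) else if f i = 0 then 1 else 0 := by
      intro i hi
      have hne : (i : ℕ) ≠ m := fun h => (Finset.ne_of_mem_erase hi) (Fin.ext h)
      have hlt : (i : ℕ) < m + 1 ↔ (i : ℕ) < m := by omega
      simp [recordEntry, hne, hlt]
    rw [Finset.prod_congr rfl e]
    by_cases h : f ⟨m, hm⟩ = x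
    · simp [recordEntry, h]
    · simp [recordEntry, h, sub_eq_zero]
  simp [key]

end Record

/-! ### Measure-and-reset as a sequential strategy. -/

section RecordStrategy

theorem sum_kronecker {d ι A : Type} [Fintype ι] (B : ι → Matrix d d ℂ) (C : Matrix A A ℂ) :
    (∑ i, B i) ⊗ₖ C = ∑ i, B i ⊗ₖ C := by
  ext
  simp [Matrix.sum_apply, Finset.sum_mul]

theorem kronecker_sum {d ι A : Type} [Fintype ι] (B : Matrix d d ℂ) (C : ι → Matrix A A ℂ) :
    B ⊗ₖ (∑ i, C i) = ∑ i, B ⊗ₖ C i := by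
  ext
  simp [Matrix.sum_apply, Finset.mul_sum]

variable {d : Type} [Fintype d]

theorem ofReal_born {ρ E : Matrix d d ℂ} (hρ : ρ.IsHermitian) (hE : E.IsHermitian) :
    (born ρ E : ℂ) = (ρ * E).trace := by
  rw [born, ← Complex.conj_eq_iff_re]
  rw [starRingEnd_apply, ← Matrix.trace_conjTranspose, Matrix.conjTranspose_mul, hρ.eq, hE.eq,
    Matrix.trace_mul_comm]

variable [DecidableEq d]

theorem isChannel_of_kraus {ι : Type} [Fintype ι] (κ : ι → Matrix d d ℂ)
    (h : ∑ i, (κ i).conjTranspose * κ i = 1) :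
    IsChannel fun ρ => ∑ i, κ i * ρ * (κ i).conjTranspose :=
  ⟨Fintype.card ι, fun i => κ ((Fintype.equivFin ι).symm i),
    by rw [(Fintype.equivFin ι).symm.sum_comp fun i => (κ i).conjTranspose * κ i, h],
    fun ρ => ((Fintype.equivFin ι).symm.sum_comp fun i => κ i * ρ * (κ i).conjTranspose).symm⟩

variable {X : Type} [Fintype X] [DecidableEq X] [AddCommGroup X]

/-- Kraus operators that measure `E`, reset the system to `ψ` and write the outcome into place `m`
of the record. -/
noncomputable def recordKraus (ψ : EuclideanSpace ℂ d) (E : X → Matrix d d ℂ) (M m : ℕ)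
    (i : X × d) : Matrix (d × (Fin M → X)) (d × (Fin M → X)) ℂ :=
  (Matrix.vecMulVec (WithLp.ofLp ψ) (Pi.single i.2 1) * E i.1)
    ⊗ₖ Equiv.Perm.permMatrix ℂ (Equiv.subRight (recordEntry M m i.1))

theorem permMatrix_conj_diagonal {R : Type} [Fintype R] [DecidableEq R] (σ : Equiv.Perm R)
    (w : R → ℂ) :
    σ.permMatrix ℂ * Matrix.diagonal w * (σ.permMatrix ℂ).conjTranspose
      = Matrix.diagonal (w ∘ σ) := by
  rw [Matrix.conjTranspose_permMatrix]
  simp only [Equiv.Perm.permMatrix, PEquiv.toMatrix_toPEquiv_mul, PEquiv.mul_toMatrix_toPEquiv,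
    Matrix.submatrix_submatrix]
  exact Matrix.submatrix_diagonal_equiv w σ

theorem conjTranspose_permMatrix_mul_self {R : Type} [Fintype R] [DecidableEq R]
    (σ : Equiv.Perm R) : (σ.permMatrix ℂ).conjTranspose * σ.permMatrix ℂ = 1 := by
  rw [Matrix.conjTranspose_permMatrix, ← Matrix.permMatrix_mul]
  simp

theorem sum_vecMulVec_single_mul (ψ : EuclideanSpace ℂ d) (A : Matrix d d ℂ) :
    ∑ b, Matrix.vecMulVec (WithLp.ofLp ψ) (Pi.single b 1) * A
      * (Matrix.vecMulVec (WithLp.ofLp ψ) (Pi.single b 1)).conjTranspose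
      = A.trace • pureState ψ := by
  ext i j
  simp [Matrix.sum_apply, Matrix.mul_apply, Matrix.vecMulVec_apply, Pi.single_apply, pureState,
    Matrix.trace, Finset.sum_mul]
  refine Finset.sum_congr rfl fun b _ => ?_
  ring

theorem sum_conjTranspose_vecMulVec_single_mul {ψ : EuclideanSpace ℂ d} (hψ : ‖ψ‖ = 1) :
    ∑ b : d, (Matrix.vecMulVec (WithLp.ofLp ψ) (Pi.single b (1 : ℂ))).conjTranspose
      * Matrix.vecMulVec (WithLp.ofLp ψ) (Pi.single b (1 : ℂ)) = 1 := by
  have h := (isDensity_pureState hψ).2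
  rw [pureState_eq_vecMulVec, Matrix.trace_vecMulVec, dotProduct_comm] at h
  simp only [Matrix.conjTranspose_vecMulVec, Matrix.vecMulVec_mul_vecMulVec, h, one_smul]
  ext i j
  simp [Matrix.sum_apply, Matrix.vecMulVec_apply, Pi.single_apply, Matrix.one_apply]

/-- The alphabet is a group so that writing an outcome is a shift of the record, hence a unitary
permutation, which cancels. The reset operators |ψ⟩⟨b| sum to the identity, leaving ∑ E x * E x;
idempotence lets each effect serve as its own square root. -/
theorem sum_recordKraus {ψ : EuclideanSpace ℂ d} (hψ : ‖ψ‖ = 1) {E : X → Matrix d d ℂ}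
    (hE : IsPOVM E) (hEE : ∀ x, E x * E x = E x) (M m : ℕ) :
    ∑ i, (recordKraus ψ E M m i).conjTranspose * recordKraus ψ E M m i = 1 := by
  have e : ∀ i : X × d, (recordKraus ψ E M m i).conjTranspose * recordKraus ψ E M m i
      = (E i.1 * ((Matrix.vecMulVec (WithLp.ofLp ψ) (Pi.single i.2 1)).conjTranspose
          * Matrix.vecMulVec (WithLp.ofLp ψ) (Pi.single i.2 (1 : ℂ))) * E i.1) ⊗ₖ 1 := by
    intro i
    rw [recordKraus, Matrix.conjTranspose_kronecker, ← Matrix.mul_kronecker_mul,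
      conjTranspose_permMatrix_mul_self, Matrix.conjTranspose_mul, (hE.1 i.1).isHermitian.eq]
    simp only [mul_assoc]
  simp only [e]
  rw [Fintype.sum_prod_type]
  have e2 : ∀ x, ∑ b, (E x * ((Matrix.vecMulVec (WithLp.ofLp ψ) (Pi.single b 1)).conjTranspose
      * Matrix.vecMulVec (WithLp.ofLp ψ) (Pi.single b (1 : ℂ))) * E x)
        ⊗ₖ (1 : Matrix (Fin M → X) (Fin M → X) ℂ) = E x ⊗ₖ 1 := by
    intro x
    rw [← sum_kronecker, ← Finset.sum_mul, ← Finset.mul_sum,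
      sum_conjTranspose_vecMulVec_single_mul hψ, mul_one, hEE]
  simp only [e2]
  rw [← sum_kronecker, hE.2, Matrix.one_kronecker_one]

/-- One round: outcome x has weight tr(EρE) = tr(ρE), the system returns to ψ whatever x is, and the
shifted weights recombine by `sum_recordWeight_sub`. System and record stay in a product state. -/
theorem recordKraus_conj (ψ : EuclideanSpace ℂ d) {E : X → Matrix d d ℂ}
    (hE : IsPOVM E) (hEE : ∀ x, E x * E x = E x) {ρ : Matrix d d ℂ} (hρ : ρ.IsHermitian)
    {M m : ℕ} (hm : m < M) :
    ∑ i, recordKraus ψ E M m i * (ρ ⊗ₖ Matrix.diagonal fun f =>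
        (recordWeight (fun x => born ρ (E x)) M m f : ℂ)) * (recordKraus ψ E M m i).conjTranspose
      = pureState ψ ⊗ₖ Matrix.diagonal fun f =>
        (recordWeight (fun x => born ρ (E x)) M (m + 1) f : ℂ) := by
  set w := recordWeight (fun x => born ρ (E x)) M with hw
  have e : ∀ i : X × d, recordKraus ψ E M m i * (ρ ⊗ₖ Matrix.diagonal fun f => (w m f : ℂ))
        * (recordKraus ψ E M m i).conjTranspose
      = (Matrix.vecMulVec (WithLp.ofLp ψ) (Pi.single i.2 1) * (E i.1 * ρ * E i.1)
          * (Matrix.vecMulVec (WithLp.ofLp ψ) (Pi.single i.2 1)).conjTranspose)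
        ⊗ₖ Matrix.diagonal fun f => (w m (f - recordEntry M m i.1) : ℂ) := by
    intro i
    rw [recordKraus, Matrix.conjTranspose_kronecker, ← Matrix.mul_kronecker_mul,
      ← Matrix.mul_kronecker_mul, permMatrix_conj_diagonal, Matrix.conjTranspose_mul,
      (hE.1 i.1).isHermitian.eq]
    simp only [mul_assoc]
    rfl
  simp only [e]
  rw [Fintype.sum_prod_type]
  simp only [← sum_kronecker, sum_vecMulVec_single_mul]
  have e2 : ∀ x, (E x * ρ * E x).trace = (born ρ (E x) : ℂ) := fun x => by
    rw [ofReal_born hρ (hE.1 x).isHermitian, Matrix.trace_mul_comm, ← mul_assoc, hEE,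
      Matrix.trace_mul_comm]
  simp only [e2, Matrix.smul_kronecker, ← Matrix.kronecker_smul]
  rw [← kronecker_sum]
  congr 1
  ext f g
  rcases eq_or_ne f g with rfl | hfg
  · simp only [Matrix.sum_apply, Matrix.smul_apply, Matrix.diagonal_apply_eq, smul_eq_mul]
    rw [hw, ← sum_recordWeight_sub _ hm]
    push_cast
    rfl
  · simp [Matrix.sum_apply, Matrix.diagonal_apply_ne _ hfg]

/-- Measure-and-reset as a sequential strategy, with the outcomes recorded in the ancilla. -/
noncomputable def recordStrategy {ψ : EuclideanSpace ℂ d} (hψ : ‖ψ‖ = 1) {E : X → Matrix d d ℂ}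
    (hE : IsPOVM E) (hEE : ∀ x, E x * E x = E x) (M : ℕ) : Strategy d where
  Ancilla := Fin M → X
  init := pureState ψ ⊗ₖ Matrix.diagonal fun f => (recordWeight (fun _ : X => 0) M 0 f : ℂ)
  isDensity_init := by
    refine ⟨(isDensity_pureState hψ).1.kronecker (Matrix.PosSemidef.diagonal fun f => ?_), ?_⟩
    · rw [recordWeight_zero]
      split_ifs <;> simp
    · simp [Matrix.trace_kronecker, (isDensity_pureState hψ).2, recordWeight_zero, apply_ite]
  control m ρ := ∑ i, recordKraus ψ E M m i * ρ * (recordKraus ψ E M m i).conjTranspose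
  isChannel_control m := isChannel_of_kraus _ (sum_recordKraus hψ hE hEE M m)
  Outcome := Fin M → X
  effect f := 1 ⊗ₖ Matrix.diagonal (Pi.single f 1)
  isPOVM_effect := by
    constructor
    · intro f
      refine Matrix.PosSemidef.one.kronecker (Matrix.PosSemidef.diagonal ?_)
      exact Pi.single_nonneg.mpr zero_le_one
    · rw [← kronecker_sum]
      convert Matrix.one_kronecker_one using 2
      ext f g
      rcases eq_or_ne f g with rfl | hfg
      · simp [Matrix.sum_apply, Pi.single_apply]
      · simp [Matrix.sum_apply, Matrix.diagonal_apply_ne _ hfg, Matrix.one_apply_ne hfg]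

theorem born_kronecker_diagonal {ψ : EuclideanSpace ℂ d} (hψ : ‖ψ‖ = 1) {R : Type} [Fintype R]
    [DecidableEq R] (w : R → ℝ) (f : R) :
    born (pureState ψ ⊗ₖ Matrix.diagonal fun f => (w f : ℂ))
      (1 ⊗ₖ Matrix.diagonal (Pi.single f 1)) = w f := by
  rw [born, ← Matrix.mul_kronecker_mul, Matrix.trace_kronecker, mul_one, (isDensity_pureState hψ).2,
    Matrix.diagonal_mul_diagonal, Matrix.trace_diagonal]
  simp [Pi.single_apply]

end RecordStrategy

/-! ### The record strategy reproduces the measure-and-reset statistics. -/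

namespace Model

variable {d : Type} [Fintype d] [DecidableEq d] {K N : ℕ} {S : Model d K N}

/-- The map (· ⊗ τ) intertwines the jump generators of L and L ⊗ 1. -/
theorem channel_extend (hS : S.IsInvolutive) (A : Type) [Fintype A] [DecidableEq A] (s t : ℝ)
    (ρ : Matrix d d ℂ) (τ : Matrix A A ℂ) :
    (S.extend A).channel s t (ρ ⊗ₖ τ) = S.channel s t ρ ⊗ₖ τ := by
  let F : Matrix d d ℂ →ₗ[ℂ] Matrix (d × A) (d × A) ℂ :=
    { toFun := fun X => X ⊗ₖ τ
      map_add' := fun X Y => Matrix.add_kronecker X Y τ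
      map_smul' := fun c X => Matrix.smul_kronecker c X τ }
  have hj : ∀ (L ρ : Matrix d d ℂ), jump (L ⊗ₖ (1 : Matrix A A ℂ)) (F ρ) = F (jump L ρ) := by
    intro L ρ
    rw [jump_apply, jump_apply, map_sub, Matrix.conjTranspose_kronecker]
    change L ⊗ₖ 1 * ρ ⊗ₖ τ * _ - _ = (L * ρ * L.conjTranspose) ⊗ₖ τ - _
    rw [← Matrix.mul_kronecker_mul, ← Matrix.mul_kronecker_mul]
    simp
  rw [hS.channel_eq, (hS.extend A).channel_eq]
  refine evolve_intertwine F _ _ (fun ρ => ?_) t ρ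
  simp only [LinearMap.add_apply, LinearMap.smul_apply, LinearMap.sum_apply, map_add, map_smul,
    map_sum, ← hj]
  rfl

theorem state_recordStrategy (hS : S.IsInvolutive) {X : Type} [Fintype X] [DecidableEq X]
    [AddCommGroup X] {ψ : EuclideanSpace ℂ d} (hψ : ‖ψ‖ = 1) {E : X → Matrix d d ℂ}
    (hE : IsPOVM E) (hEE : ∀ x, E x * E x = E x) (M : ℕ) (s : ℝ) {t : ℝ} (ht : 0 ≤ t) {m : ℕ}
    (hm : m ≤ M) :
    (recordStrategy hψ hE hEE M).state S s t m = pureState ψ ⊗ₖ Matrix.diagonal fun f =>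
      (recordWeight (fun x => born (S.channel s t (pureState ψ)) (E x)) M m f : ℂ) := by
  induction m with
  | zero => simp only [Strategy.state, recordStrategy, recordWeight_zero]
  | succ m ih =>
    rw [Strategy.state, ih (by omega)]
    -- Only the fact that the evolved state is a density matrix is wanted, for every s; the base
    -- point 1 is arbitrary.
    have hD := (hS.hasSimulation_channel one_pos ht
      (hasSimulation_const (isDensity_pureState hψ) 1)).isDensity s
    rw [← recordKraus_conj ψ hE hEE hD.1.isHermitian (by omega : m < M)]
    have := channel_extend hS (Fin M → X) s t (pureState ψ) (Matrix.diagonal fun f =>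
      (recordWeight (fun x => born (S.channel s t (pureState ψ)) (E x)) M m f : ℂ))
    rw [← this]
    rfl

/-- Reading the ancilla after M rounds gives exactly the product distribution of the M outcomes. -/
theorem measureResetInfo_le_sequentialQFI (hS : S.IsInvolutive) {X : Type} [Fintype X]
    [DecidableEq X] [AddCommGroup X] {ψ : EuclideanSpace ℂ d} (hψ : ‖ψ‖ = 1)
    {E : X → Matrix d d ℂ} (hE : IsPOVM E) (hEE : ∀ x, E x * E x = E x) {T : ℝ} (hT : 0 ≤ T)
    (M : ℕ) (s : ℝ) :
    ENNReal.ofReal (S.measureResetInfo ψ E T M s) ≤ S.sequentialQFI T M s := by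
  have e : ∀ (s' : ℝ) (f : Fin M → X),
      born ((recordStrategy hψ hE hEE M).state S s' (T / M) M)
        ((recordStrategy hψ hE hEE M).effect f)
      = ∏ m, born (S.channel s' (T / M) (pureState ψ)) (E (f m)) := by
    intro s' f
    rw [state_recordStrategy hS hψ hE hEE M s' (by positivity) le_rfl]
    exact (born_kronecker_diagonal hψ _ f).trans (recordWeight_self _ M f)
  have e2 : S.measureResetInfo ψ E T M s = fisherInfo
      (fun s' (f : (recordStrategy hψ hE hEE M).Outcome) =>
        born ((recordStrategy hψ hE hEE M).state S s' (T / M) M)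
          ((recordStrategy hψ hE hEE M).effect f)) s :=
    congrArg (fun p => fisherInfo p s) (funext fun s' => funext fun f => (e s' f).symm)
  rw [e2]
  exact le_iSup (fun C : Strategy d => ENNReal.ofReal
    (fisherInfo (fun s' (x : C.Outcome) => born (C.state S s' (T / M) M) (C.effect x)) s))
    (recordStrategy hψ hE hEE M)

end Model


/-! ### Algebra of Pauli strings. -/

section TensorProduct

variable {n : ℕ}

/-- The operator `⊗ᵢ A i` on `n` qubits. -/
noncomputable def qubitTensor (A : Fin n → Matrix (Fin 2) (Fin 2) ℂ) :
    Matrix (Fin n → Fin 2) (Fin n → Fin 2) ℂ :=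
  Matrix.of fun x y => ∏ i, A i (x i) (y i)

theorem sum_prod_qubits (F : Fin n → Fin 2 → ℂ) :
    ∑ x : Fin n → Fin 2, ∏ i, F i (x i) = ∏ i, ∑ b, F i b := by
  have := Finset.prod_univ_sum (fun _ : Fin n => (Finset.univ : Finset (Fin 2))) F
  simpa using this.symm

theorem qubitTensor_mul (A B : Fin n → Matrix (Fin 2) (Fin 2) ℂ) :
    qubitTensor A * qubitTensor B = qubitTensor fun i => A i * B i := by
  ext x z
  simp only [qubitTensor, Matrix.mul_apply, Matrix.of_apply, ← Finset.prod_mul_distrib]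
  exact sum_prod_qubits fun i y => A i (x i) y * B i y (z i)

theorem qubitTensor_one : qubitTensor (fun _ : Fin n => 1) = 1 := by
  ext x y
  simp [qubitTensor, Matrix.one_apply, Finset.prod_ite_zero, funext_iff]

theorem qubitTensor_conjTranspose (A : Fin n → Matrix (Fin 2) (Fin 2) ℂ) :
    (qubitTensor A).conjTranspose = qubitTensor fun i => (A i).conjTranspose := by
  ext x y
  simp [qubitTensor]

theorem trace_qubitTensor (A : Fin n → Matrix (Fin 2) (Fin 2) ℂ) :
    (qubitTensor A).trace = ∏ i, (A i).trace :=
  sum_prod_qubits fun i b => A i b b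

theorem pauli_isHermitian (a : Fin 4) : (pauli a).conjTranspose = pauli a := by
  ext i j
  fin_cases a <;> fin_cases i <;> fin_cases j <;> simp [pauli]

theorem pauli_mul_self (a : Fin 4) : pauli a * pauli a = 1 := by
  ext i j
  fin_cases a <;> fin_cases i <;> fin_cases j <;> simp [pauli, Matrix.mul_apply]

theorem trace_pauli_mul {a b : Fin 4} (h : a ≠ b) : (pauli a * pauli b).trace = 0 := by
  fin_cases a <;> fin_cases b <;> first | exact absurd rfl h | simp [pauli, Matrix.trace]

theorem pauliString_isHermitian (w : Fin n → Fin 4) : (pauliString w).IsHermitian := by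
  change (qubitTensor fun i => pauli (w i)).conjTranspose = qubitTensor fun i => pauli (w i)
  simp only [qubitTensor_conjTranspose, pauli_isHermitian]

theorem pauliString_mul_self (w : Fin n → Fin 4) : pauliString w * pauliString w = 1 := by
  change qubitTensor (fun i => pauli (w i)) * qubitTensor (fun i => pauli (w i)) = 1
  simp only [qubitTensor_mul, pauli_mul_self, qubitTensor_one]

/-- The trace factorises over qubits, and at a site where the strings differ the factor is
traceless. Distinctness of signals from noise enters the proof here. -/
theorem trace_pauliString_mul {w w' : Fin n → Fin 4} (h : w ≠ w') :
    (pauliString w * pauliString w').trace = 0 := by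
  change (qubitTensor (fun i => pauli (w i)) * qubitTensor (fun i => pauli (w' i))).trace = 0
  obtain ⟨i, hi⟩ := Function.ne_iff.mp h
  rw [qubitTensor_mul, trace_qubitTensor]
  exact Finset.prod_eq_zero (Finset.mem_univ i) (trace_pauli_mul hi)

theorem pauliModel_isInvolutive {K N : ℕ} {sig : Fin K → Fin n → Fin 4}
    {noi : Fin N → Fin n → Fin 4} {γ : Fin N → ℝ}
    (hcomm : ∀ a b,
      Commute (pauliString (Sum.elim sig noi a)) (pauliString (Sum.elim sig noi b)))
    (hγ : ∀ k, 0 ≤ γ k) : (pauliModel sig noi γ).IsInvolutive where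
  jumps := by
    have e : Sum.elim (pauliModel sig noi γ).signal (pauliModel sig noi γ).noise
        = fun a => pauliString (Sum.elim sig noi a) := by
      funext a
      cases a <;> rfl
    rw [e]
    exact ⟨fun a => pauliString_isHermitian _, fun a => pauliString_mul_self _, hcomm⟩
  rate_nonneg := hγ

end TensorProduct

/-! ### Joint eigenbases and their uniform superpositions. -/

section Eigenbasis

open Module.End

variable {d : Type} [Fintype d] [DecidableEq d]

/-- Commuting symmetric operators have joint eigenspaces spanning the whole space. Eigenvalues of
involutions are ±1, so the finitely many sign patterns suffice as indices, and a basis subordinate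
to a finite orthogonal decomposition can be chosen. -/
theorem IsInvolutive.exists_eigenbasis {J : Type} [Finite J] {L : J → Matrix d d ℂ}
    (hL : IsInvolutive L) :
    ∃ e : OrthonormalBasis d ℂ (EuclideanSpace ℂ d), ∀ j a, ∃ c : ℂ, op (L j) (e a) = c • e a := by
  classical
  have := Fintype.ofFinite J
  have hT : ∀ j, (op (L j)).IsSymmetric := fun j =>
    Matrix.isSymmetric_toEuclideanLin_iff.mpr (hL.isHermitian j)
  have hC : Pairwise (Function.onFun Commute fun j => op (L j)) := fun i j _ =>
    LinearMap.ext fun v => by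
      rw [Module.End.mul_apply, Module.End.mul_apply, ← op_mul, ← op_mul, (hL.commute i j).eq]
  let sgn : (J → Fin 2) → J → ℂ := fun χ j => if χ j = 0 then 1 else -1
  have hsgn : Function.Injective sgn := by
    intro χ χ' h
    funext j
    have hj := congrFun h j
    simp only [sgn] at hj
    generalize χ j = x at *
    generalize χ' j = y at *
    fin_cases x <;> fin_cases y <;> norm_num at hj <;> rfl
  have hV := (LinearMap.IsSymmetric.orthogonalFamily_iInf_eigenspaces hT).comp hsgn
  have htop : ⨆ χ, ⨅ j, eigenspace (op (L j)) (sgn χ j) = ⊤ := by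
    rw [eq_top_iff, ← LinearMap.IsSymmetric.iSup_iInf_eq_top_of_commute hT hC]
    refine iSup_le fun α => ?_
    by_cases hα : ∀ j, α j = 1 ∨ α j = -1
    · refine le_iSup_of_le (fun j => if α j = 1 then 0 else 1) (le_of_eq ?_)
      congr 1
      funext j
      congr 1
      rcases hα j with h | h
      · simp [sgn, h]
      · simp only [sgn, h]
        norm_num
    · push Not at hα
      obtain ⟨j, h1, h2⟩ := hα
      -- A joint eigenvalue α j other than ±1 has only v = 0, since the square of L j is 1 and hence
      -- v = (α j)² v.
      intro v hv
      have hv' := mem_eigenspace_iff.mp ((Submodule.mem_iInf _).mp hv j)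
      have h3 : v = (α j * α j) • v := by
        conv_lhs => rw [← op_one v, ← hL.mul_self j, op_mul, hv', map_smul, hv', smul_smul]
      have h4 : (1 - α j * α j) • v = 0 := by rw [sub_smul, one_smul, ← h3, sub_self]
      rcases smul_eq_zero.mp h4 with h | h
      · exfalso
        have : (1 - α j) * (1 + α j) = 0 := by linear_combination h
        rcases mul_eq_zero.mp this with h | h
        · exact h1 (by linear_combination -h)
        · exact h2 (by linear_combination h)
      · rw [h]
        exact Submodule.zero_mem _
  have hI : DirectSum.IsInternal fun χ => ⨅ j, eigenspace (op (L j)) (sgn χ j) := by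
    rw [OrthogonalFamily.isInternal_iff hV, Submodule.orthogonal_eq_bot_iff]
    exact htop
  let b := hI.subordinateOrthonormalBasis (finrank_euclideanSpace (𝕜 := ℂ) (ι := d)) hV
  refine ⟨b.reindex (Fintype.equivFin d).symm, fun j a => ?_⟩
  have hb := hI.subordinateOrthonormalBasis_subordinate
    (finrank_euclideanSpace (𝕜 := ℂ) (ι := d)) (Fintype.equivFin d a) hV
  have hj := mem_eigenspace_iff.mp ((Submodule.mem_iInf _).mp hb j)
  rw [OrthonormalBasis.reindex_apply]
  exact ⟨_, hj⟩

theorem trace_eq_sum_inner_op (A : Matrix d d ℂ) (e : OrthonormalBasis d ℂ (EuclideanSpace ℂ d)) :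
    A.trace = ∑ a, inner ℂ (e a) (op A (e a)) := by
  rw [← LinearMap.trace_eq_sum_inner]
  exact (Matrix.trace_toLin_eq A (PiLp.basisFun 2 ℂ d)).symm

theorem ofReal_one_div_sqrt_mul_self (m : ℕ) :
    ((1 / Real.sqrt m : ℝ) : ℂ) * ((1 / Real.sqrt m : ℝ) : ℂ) = 1 / (m : ℂ) := by
  rw [← Complex.ofReal_mul, div_mul_div_comm, Real.mul_self_sqrt (Nat.cast_nonneg _)]
  simp

/-- Cross terms vanish by orthonormality, so the expectation is the mean of the eigenvalues. -/
theorem inner_uniformSuperposition {A : Matrix d d ℂ}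
    {e : OrthonormalBasis d ℂ (EuclideanSpace ℂ d)} (h : ∀ a, ∃ c : ℂ, op A (e a) = c • e a) :
    inner ℂ (uniformSuperposition e) (op A (uniformSuperposition e))
      = A.trace / Fintype.card d := by
  choose c hc using h
  have hs : ((1 / Real.sqrt (Fintype.card d) : ℝ) : ℂ) * ((1 / Real.sqrt (Fintype.card d) : ℝ) : ℂ)
      = 1 / (Fintype.card d : ℂ) := ofReal_one_div_sqrt_mul_self _
  rw [trace_eq_sum_inner_op A e, uniformSuperposition, map_smul, inner_smul_left, inner_smul_right,
    Complex.conj_ofReal, ← mul_assoc, hs, map_sum]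
  simp only [hc, sum_inner, inner_sum, inner_smul_right, e.inner_eq_ite]
  simp
  ring

theorem norm_uniformSuperposition [Nonempty d] (e : OrthonormalBasis d ℂ (EuclideanSpace ℂ d)) :
    ‖uniformSuperposition e‖ = 1 := by
  have h := inner_uniformSuperposition (A := 1) (e := e) fun a => ⟨1, by rw [op_one, one_smul]⟩
  rw [op_one, Matrix.trace_one, div_self (by simp)] at h
  rw [@norm_eq_sqrt_re_inner ℂ, h]
  simp

end Eigenbasis


/-! ### Combining the bounds into limiting values. -/

theorem isVanishingSignalValue_of_tendsto {F : ℕ → ℝ → ℝ≥0∞} {v : ℝ≥0∞}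
    (h : ∀ s, 0 < s → Filter.Tendsto (fun M => F M s) Filter.atTop (𝓝 v)) :
    IsVanishingSignalValue F v :=
  ⟨fun _ => v, h, tendsto_const_nhds⟩

namespace Model

variable {d : Type} [Fintype d] [DecidableEq d] {K N : ℕ} {S : Model d K N}
  {ψ : EuclideanSpace ℂ d}

theorem noisyProjection_mul_self (S : Model d K N) (ψ : EuclideanSpace ℂ d) :
    S.noisyProjection ψ * S.noisyProjection ψ = S.noisyProjection ψ := by
  apply Matrix.toEuclideanLin.injective
  refine LinearMap.ext fun φ => ?_
  change op _ φ = op _ φ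
  rw [op_mul, op_noisyProjection, op_noisyProjection]
  exact Submodule.starProjection_eq_self_iff.mpr (Submodule.starProjection_apply_mem _ _)

theorem noisyMeasurement_mul_self (S : Model d K N) (ψ : EuclideanSpace ℂ d) (x : Fin 2) :
    S.noisyMeasurement ψ x * S.noisyMeasurement ψ x = S.noisyMeasurement ψ x := by
  fin_cases x
  · exact S.noisyProjection_mul_self ψ
  · change (1 - S.noisyProjection ψ) * (1 - S.noisyProjection ψ) = 1 - S.noisyProjection ψ
    rw [mul_sub, sub_mul, sub_mul, S.noisyProjection_mul_self ψ]
    simp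

theorem mem_orthogonal_noisySubspace {φ : EuclideanSpace ℂ d} (h0 : inner ℂ ψ φ = 0)
    (h : ∀ k, inner ℂ (op (S.noise k) ψ) φ = 0) : φ ∈ (S.noisySubspace ψ)ᗮ := by
  have hle : S.noisySubspace ψ ≤ (Submodule.span ℂ {φ})ᗮ := by
    refine Submodule.span_le.mpr ?_
    rintro _ (rfl | ⟨k, rfl⟩)
    · exact Submodule.mem_orthogonal_singleton_iff_inner_left.mpr h0
    · exact Submodule.mem_orthogonal_singleton_iff_inner_left.mpr (h k)
  exact (Submodule.le_orthogonal_iff_le_orthogonal.mp hle) (Submodule.mem_span_singleton_self φ)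

theorem isVanishingSignalValue_noisyMeasurement (hS : S.IsInvolutive) (hψ : ‖ψ‖ = 1)
    (h : ∀ j, op (S.signal j) ψ ∈ (S.noisySubspace ψ)ᗮ) {T : ℝ} (hT : 0 < T) :
    IsVanishingSignalValue
      (fun M s => ENNReal.ofReal (S.measureResetInfo ψ (S.noisyMeasurement ψ) T M s))
      (ENNReal.ofReal (4 * K * T)) :=
  isVanishingSignalValue_of_tendsto fun _ hs =>
    ENNReal.tendsto_ofReal (tendsto_measureResetInfo hS hψ h hT hs)

theorem isVanishingSignalValue_measureResetQFI (hS : S.IsInvolutive) (hψ : ‖ψ‖ = 1)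
    (h : ∀ j, op (S.signal j) ψ ∈ (S.noisySubspace ψ)ᗮ) {T : ℝ} (hT : 0 < T) :
    IsVanishingSignalValue (S.measureResetQFI ψ T) (ENNReal.ofReal (4 * K * T)) := by
  refine isVanishingSignalValue_of_tendsto fun s hs => ?_
  refine tendsto_of_tendsto_of_tendsto_of_le_of_le
    (ENNReal.tendsto_ofReal (tendsto_measureResetInfo hS hψ h hT hs)) tendsto_const_nhds
    (fun M => ?_) (fun M => measureResetQFI_le hS (isDensity_pureState hψ) hT.le hs M)
  exact le_iSup₂_of_le (Fin 2) inferInstance <|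
    le_iSup₂_of_le (S.noisyMeasurement ψ) (S.isPOVM_noisyMeasurement ψ) le_rfl

theorem isVanishingSignalValue_sequentialQFI (hS : S.IsInvolutive) (hψ : ‖ψ‖ = 1)
    (h : ∀ j, op (S.signal j) ψ ∈ (S.noisySubspace ψ)ᗮ) {T : ℝ} (hT : 0 < T) :
    IsVanishingSignalValue (S.sequentialQFI T) (ENNReal.ofReal (4 * K * T)) := by
  refine isVanishingSignalValue_of_tendsto fun s hs => ?_
  exact tendsto_of_tendsto_of_tendsto_of_le_of_le
    (ENNReal.tendsto_ofReal (tendsto_measureResetInfo hS hψ h hT hs)) tendsto_const_nhds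
    (fun M => measureResetInfo_le_sequentialQFI hS hψ (S.isPOVM_noisyMeasurement ψ)
      (S.noisyMeasurement_mul_self ψ) hT.le M s)
    (fun M => sequentialQFI_le hS hT.le hs M)

theorem inner_op_one_sub_noisyProjection {B : Matrix d d ℂ}
    (hB : op B ψ ∈ (S.noisySubspace ψ)ᗮ) :
    inner ℂ ψ (op (B.conjTranspose * (1 - S.noisyProjection ψ) * B) ψ)
      = inner ℂ ψ (op (B.conjTranspose * B) ψ) := by
  rw [op_mul, op_mul, op_mul, op_one_sub_noisyProjection,
    Submodule.starProjection_eq_self_iff.mpr hB]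

end Model

/-! ### Variances and the maximally entangled state. -/

theorem variance_eq_one_sub {d : Type} [Fintype d] [DecidableEq d] {U : Matrix d d ℂ}
    (hU : U.conjTranspose * U = 1) {φ : EuclideanSpace ℂ d} (hφ : ‖φ‖ = 1) :
    variance φ U = 1 - ‖inner ℂ φ (op U φ)‖ ^ 2 := by
  rw [variance, hU, op_one, inner_self_eq_norm_sq_to_K, hφ]
  simp

/-- The maximally entangled state of two copies of a system. -/
noncomputable def maximallyEntangled (d : Type) [Fintype d] [DecidableEq d] :
    EuclideanSpace ℂ (d × d) :=
  WithLp.toLp 2 fun z => if z.1 = z.2 then ((1 / Real.sqrt (Fintype.card d) : ℝ) : ℂ) else 0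

theorem op_kronecker_maximallyEntangled {d : Type} [Fintype d] [DecidableEq d]
    (B : Matrix d d ℂ) :
    op (B ⊗ₖ (1 : Matrix d d ℂ)) (maximallyEntangled d)
      = WithLp.toLp 2 fun z => B z.1 z.2 * ((1 / Real.sqrt (Fintype.card d) : ℝ) : ℂ) := by
  ext z
  simp [maximallyEntangled, Fintype.sum_prod_type, Matrix.mulVec, dotProduct, Matrix.one_apply, op]

theorem inner_maximallyEntangled {d : Type} [Fintype d] [DecidableEq d] (B : Matrix d d ℂ) :
    inner ℂ (maximallyEntangled d) (op (B ⊗ₖ (1 : Matrix d d ℂ)) (maximallyEntangled d))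
      = B.trace / Fintype.card d := by
  have hs : ((1 / Real.sqrt (Fintype.card d) : ℝ) : ℂ) * ((1 / Real.sqrt (Fintype.card d) : ℝ) : ℂ)
      = 1 / (Fintype.card d : ℂ) := ofReal_one_div_sqrt_mul_self _
  rw [op_kronecker_maximallyEntangled, EuclideanSpace.inner_eq_star_dotProduct]
  simp only [dotProduct, maximallyEntangled, Pi.star_apply, apply_ite star, star_zero,
    Fintype.sum_prod_type, mul_ite, mul_zero, Finset.sum_ite_eq, Finset.mem_univ, if_true]
  rw [Matrix.trace, div_eq_mul_one_div _ (Fintype.card d : ℂ), ← hs, Finset.sum_mul]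
  refine Finset.sum_congr rfl fun i _ => ?_
  rw [RCLike.star_def, Complex.conj_ofReal, Matrix.diag_apply]
  ring

theorem norm_maximallyEntangled (d : Type) [Fintype d] [DecidableEq d] [Nonempty d] :
    ‖maximallyEntangled d‖ = 1 := by
  have h := inner_maximallyEntangled (1 : Matrix d d ℂ)
  rw [Matrix.one_kronecker_one, op_one, Matrix.trace_one, div_self (by simp)] at h
  rw [@norm_eq_sqrt_re_inner ℂ, h]
  simp

namespace Model

variable {d : Type} [Fintype d] [DecidableEq d] {K N : ℕ} {S : Model d K N}

/-- Each variance of a unitary is at most 1, with equality when its expectation vanishes. The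
maximally entangled state achieves this for all signals at once: there L ⊗ 1 has expectation tr L /
d = 0. -/
theorem isGreatest_sum_variance [Nonempty d] (hS : S.IsInvolutive)
    (htr : ∀ j, (S.signal j).trace = 0) {T : ℝ} (hT : 0 < T) :
    IsGreatest {v : ℝ | ∃ (A : Type) (_ : Fintype A) (_ : DecidableEq A)
      (φ : EuclideanSpace ℂ (d × A)), ‖φ‖ = 1 ∧
        v = 4 * T * ∑ j, variance φ ((S.extend A).signal j)} (4 * K * T) := by
  constructor
  · refine ⟨d, inferInstance, inferInstance, maximallyEntangled d, norm_maximallyEntangled d, ?_⟩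
    have : ∀ j, variance (maximallyEntangled d) ((S.extend d).signal j) = 1 := fun j => by
      rw [variance_eq_one_sub (U := (S.extend d).signal j)
        ((hS.extend d).jumps.conjTranspose_mul_self (.inl j))
        (norm_maximallyEntangled d)]
      change 1 - ‖inner ℂ _ (op (S.signal j ⊗ₖ (1 : Matrix d d ℂ)) _)‖ ^ 2 = 1
      rw [inner_maximallyEntangled, htr]
      simp
    simp [this]
    ring
  · rintro v ⟨A, _, _, φ, hφ, rfl⟩
    have : ∀ j, variance φ ((S.extend A).signal j) ≤ 1 := fun j => by
      rw [variance_eq_one_sub (U := (S.extend A).signal j)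
        ((hS.extend A).jumps.conjTranspose_mul_self (.inl j)) hφ]
      simp
    have h2 : ∑ j, variance φ ((S.extend A).signal j) ≤ K := by
      simpa using Finset.sum_le_sum fun j (_ : j ∈ Finset.univ) => this j
    calc _ ≤ 4 * T * (K : ℝ) := by gcongr
      _ = 4 * K * T := by ring

/-- Noise times signal is again diagonal in the joint eigenbasis, so each overlap of a signal image
with ψ or with a noise image is a normalised trace, which vanishes. -/
theorem signal_mem_orthogonal_of_trace (hS : S.IsInvolutive) (htr : ∀ j, (S.signal j).trace = 0)
    (htr2 : ∀ k j, (S.noise k * S.signal j).trace = 0)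
    {e : OrthonormalBasis d ℂ (EuclideanSpace ℂ d)} (he : IsEigenbasis S e) (j : Fin K) :
    op (S.signal j) (uniformSuperposition e) ∈ (S.noisySubspace (uniformSuperposition e))ᗮ := by
  refine mem_orthogonal_noisySubspace ?_ fun k => ?_
  · rw [inner_uniformSuperposition (he.1 j), htr, zero_div]
  · have hk : (S.noise k).conjTranspose = S.noise k := (hS.jumps.isHermitian (.inr k)).eq
    rw [inner_op, hk, ← op_mul, inner_uniformSuperposition, htr2, zero_div]
    intro a
    obtain ⟨c, hc⟩ := he.1 j a
    obtain ⟨c', hc'⟩ := he.2 k a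
    exact ⟨c * c', by rw [op_mul, hc, map_smul, hc', smul_smul]⟩

theorem four_mul_sum_inner_noisyProjection (hS : S.IsInvolutive) {ψ : EuclideanSpace ℂ d}
    (hψ : ‖ψ‖ = 1) (h : ∀ j, op (S.signal j) ψ ∈ (S.noisySubspace ψ)ᗮ) (T : ℝ) :
    4 * T * ∑ j, (inner ℂ ψ (op ((S.signal j).conjTranspose * (1 - S.noisyProjection ψ)
      * S.signal j) ψ)).re = 4 * K * T := by
  have : ∀ j, (inner ℂ ψ (op ((S.signal j).conjTranspose * (1 - S.noisyProjection ψ)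
      * S.signal j) ψ)).re = 1 := fun j => by
    have hU : (S.signal j).conjTranspose * S.signal j = 1 :=
      hS.jumps.conjTranspose_mul_self (.inl j)
    rw [inner_op_one_sub_noisyProjection (h j), hU, op_one, inner_self_eq_norm_sq_to_K, hψ]
    simp
  rw [Finset.sum_congr rfl fun j _ => this j]
  simp only [Finset.sum_const, Finset.card_univ, Fintype.card_fin, nsmul_eq_mul, mul_one]
  ring

theorem IsInvolutive.exists_isEigenbasis (hS : S.IsInvolutive) : ∃ e, IsEigenbasis S e := by
  obtain ⟨e, he⟩ := hS.jumps.exists_eigenbasis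
  exact ⟨e, fun j => he (.inl j), fun k => he (.inr k)⟩

end Model

end LindbladSensing

open LindbladSensing
theorem mainTheorem7 (n K N : ℕ)
    (sig : Fin K → Fin n → Fin 4) (noi : Fin N → Fin n → Fin 4)
    (hdistinct : Function.Injective (Sum.elim sig noi))
    (htraceless : ∀ a, (pauliString (Sum.elim sig noi a)).trace = 0)
    (hcomm : ∀ a b,
      Commute (pauliString (Sum.elim sig noi a)) (pauliString (Sum.elim sig noi b)))
    (γ : Fin N → ℝ) (hγ : ∀ k, 0 < γ k) (T : ℝ) (hT : 0 < T) :
    -- the noiseless QFI, as the optimum over all extended sequential strategies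
    IsVanishingSignalValue ((pauliModel sig noi γ).noiseless.sequentialQFI T)
      (ENNReal.ofReal (4 * K * T)) ∧
    -- the noiseless QFI, as the largest sum of variances over all extended pure states
    IsGreatest {v : ℝ | ∃ (A : Type) (_ : Fintype A) (_ : DecidableEq A)
        (φ : EuclideanSpace ℂ ((Fin n → Fin 2) × A)), ‖φ‖ = 1 ∧
          v = 4 * T * ∑ j, variance φ (((pauliModel sig noi γ).extend A).signal j)}
      (4 * K * T) ∧
    (∃ e, IsEigenbasis (pauliModel sig noi γ) e) ∧
    ∀ e, IsEigenbasis (pauliModel sig noi γ) e →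
      ‖uniformSuperposition e‖ = 1 ∧
      -- the unextended measure-and-reset strategy recovers it in the presence of the noise
      IsVanishingSignalValue
        ((pauliModel sig noi γ).measureResetQFI (uniformSuperposition e) T)
        (ENNReal.ofReal (4 * K * T)) ∧
      -- and does so by projecting onto the noisy subspace
      IsPOVM ((pauliModel sig noi γ).noisyMeasurement (uniformSuperposition e)) ∧
      IsVanishingSignalValue
        (fun M s => ENNReal.ofReal ((pauliModel sig noi γ).measureResetInfo
          (uniformSuperposition e)
          ((pauliModel sig noi γ).noisyMeasurement (uniformSuperposition e)) T M s))
        (ENNReal.ofReal (4 * K * T)) ∧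
      4 * T * ∑ j, (inner ℂ (uniformSuperposition e)
        (op ((pauliString (sig j)).conjTranspose
            * (1 - (pauliModel sig noi γ).noisyProjection (uniformSuperposition e))
            * pauliString (sig j)) (uniformSuperposition e))).re = 4 * K * T := by
  set S := pauliModel sig noi γ with hSdef
  have hS : S.IsInvolutive := pauliModel_isInvolutive hcomm fun k => (hγ k).le
  have htr : ∀ j, (S.signal j).trace = 0 := fun j => htraceless (.inl j)
  have htr2 : ∀ k j, (S.noise k * S.signal j).trace = 0 := fun k j =>
    trace_pauliString_mul fun h => Sum.inr_ne_inl (hdistinct (a₁ := .inr k) (a₂ := .inl j) h)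
  have horth := fun e (he : IsEigenbasis S e) => Model.signal_mem_orthogonal_of_trace hS htr htr2 he
  obtain ⟨e₀, he₀⟩ := hS.exists_isEigenbasis
  -- Without noise operators the noisy subspace is the line through ψ, and the noise conditions are
  -- vacuous.
  have horth₀ := Model.signal_mem_orthogonal_of_trace (e := e₀) hS.noiseless htr
    (fun k => k.elim0) ⟨he₀.1, fun k => k.elim0⟩
  refine ⟨Model.isVanishingSignalValue_sequentialQFI hS.noiseless (norm_uniformSuperposition e₀)
    horth₀ hT, Model.isGreatest_sum_variance hS htr hT, ⟨e₀, he₀⟩, fun e he => ?_⟩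
  have hψ := norm_uniformSuperposition e
  exact ⟨hψ, Model.isVanishingSignalValue_measureResetQFI hS hψ (horth e he) hT,
    S.isPOVM_noisyMeasurement _,
    Model.isVanishingSignalValue_noisyMeasurement hS hψ (horth e he) hT,
    Model.four_mul_sum_inner_noisyProjection hS hψ (horth e he) T⟩
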